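/- A function is called 2-to-1 if the preimage of each point of its image has exactly two points; a continuum is a compact connected metrizable space. For integers $n\ge 1$ let $S_n=\{(x,y)\in\mathbb R^2 : (x+\tfrac{n-1}{n})^2+y^2=\tfrac1{n^2},\ y\ge 0\}$, and let $S=\{(x,y): x^2+y^2\le 1\}\setminus\bigcup_{n\ge1}S_n$. For $n\ge1$ let $L_n=\{(x,y):(x+\tfrac{n-1}{n})^2+y^2=\tfrac1{n^2},\ y<0\}$ and $A_n=\{(x,0): \tfrac{1-n}{n+1}<x<\tfrac{2-n}{n}\}$. (a) (K. Kuperberg) There are a boundary point $p$ of the unit square $Q=[0,1]^2$, a homeomorphism $h:Q\setminus\{p\}\to S$ and homeomorphisms $\varphi_k:A_k\to L_{k+1}$ $(k\ge1)$ with the following properties. Let $I$ be the quotient space of $S$ under the equivalence relation generated by $(x,y)\sim(x,-y)$ for $(x,y)\in S$ with $y>0$; $(x,y)\sim(-x,y)$ for $(x,y)\in L_1$; and $a\sim\varphi_k(a)$ for $a\in A_k$, $k\ge1$. Let $f:S\to I$ be the quotient map, and let $g:Q\to I$ be $g=f\circ h$ on $Q\setminus\{p\}$ and $g(p)=f((0,-1))$.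 Then: 1. $f$ is continuous, $f^{-1}(f(s))$ has exactly two points for every $s\in S$, $s\neq(0,-1)$, and $f^{-1}(f((0,-1)))=\{(0,-1)\}$; 2. $I$ is metrizable, locally compact, connected and not compact; 3. $g$ maps $Q$ onto $I$, is 2-to-1, and has exactly one point of discontinuity, namely $p$; 4. for every point $c\in I$, let $Y_c$ be the space obtained from the one-point compactification of $I$ by identifying the added point with $c$. Then $Y_c$ is a continuum, the canonical map $j_c:I\to Y_c$ is a continuous bijection, and $j_c\circ g$ maps $Q$ onto $Y_c$, is 2-to-1, and has exactly one point of discontinuity, namely $p$. (b) For every $n\ge 2$ there is a 2-to-1 function from the closed unit ball of $\mathbb R^n$ onto a metric space which has exactly one point of discontinuity. (For $n=2$ this is the unit disk.) -/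

import Mathlib

open Set Topology

namespace Kuperberg

/-- `f` is (exactly) 2-to-1: every point of the image of `f` has exactly two preimages. -/
def IsTwoToOne {X Y : Type*} (f : X → Y) : Prop :=
  ∀ y ∈ range f, (f ⁻¹' {y}).ncard = 2

/-- The unit square `[0,1] × [0,1]`. -/
def unitSquare : Set (ℝ × ℝ) := Icc 0 1 ×ˢ Icc 0 1

/-- For `n ≥ 1`, the closed upper half of the circle of centre `(-(n-1)/n, 0)` and radius `1/n`. -/
def semicircle (n : ℕ) : Set (ℝ × ℝ) :=
  {q | (q.1 + ((n : ℝ) - 1) / n) ^ 2 + q.2 ^ 2 = 1 / (n : ℝ) ^ 2 ∧ 0 ≤ q.2}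

/-- The closed unit disk with the semicircles `semicircle n`, `n ≥ 1`, removed. -/
def slitDisk : Set (ℝ × ℝ) :=
  {q | q.1 ^ 2 + q.2 ^ 2 ≤ 1} \ ⋃ (n : ℕ) (_ : 1 ≤ n), semicircle n

/-- For `n ≥ 1`, the mirror image in the `x`-axis of `semicircle n`, without its endpoints. -/
def lowerArc (n : ℕ) : Set (ℝ × ℝ) :=
  {q | (q.1 + ((n : ℝ) - 1) / n) ^ 2 + q.2 ^ 2 = 1 / (n : ℝ) ^ 2 ∧ q.2 < 0}

/-- For `n ≥ 1`, the open interval of the `x`-axis between the right endpoint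
`(2 - (n+1)) / (n+1)` of `semicircle (n+1)` and the right endpoint `(2 - n) / n`
of `semicircle n`. -/
def axisInterval (n : ℕ) : Set (ℝ × ℝ) :=
  {q | (1 - (n : ℝ)) / (n + 1) < q.1 ∧ q.1 < (2 - (n : ℝ)) / n ∧ q.2 = 0}

theorem bottom_mem : ((0, -1) : ℝ × ℝ) ∈ slitDisk := by
  refine ⟨by norm_num, ?_⟩
  simp only [mem_iUnion, not_exists]
  rintro n - ⟨-, h⟩
  norm_num at h

/-- The point `(0,-1)` of the slit disk. -/
def bottom : slitDisk := ⟨(0, -1), bottom_mem⟩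

/-- A choice of homeomorphisms for the pairwise identification of the remaining intervals,
listed as `axisInterval 1, lowerArc 2, axisInterval 2, lowerArc 3, …`:
the first with the second, the third with the fourth, and so on. -/
abbrev Pairing : Type := (k : ℕ) → (axisInterval (k + 1) ≃ₜ lowerArc (k + 2))

/-- The identifications made on the slit disk. -/
inductive Glue (φ : Pairing) : slitDisk → slitDisk → Prop
  /-- `(x,y)` with `y > 0` is identified with `(x,-y)`. -/
  | reflect (q q' : slitDisk) (hq : 0 < q.1.2) (h : q'.1 = (q.1.1, -q.1.2)) : Glue φ q q'
  /-- `(x,y)` on the open lower unit semicircle is identified with `(-x,y)`. -/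
  | fold (q q' : slitDisk) (hq : q.1 ∈ lowerArc 1) (h : q'.1 = (-q.1.1, q.1.2)) : Glue φ q q'
  /-- The remaining intervals are identified in pairs. -/
  | pair (k : ℕ) (q q' : slitDisk) (hq : q.1 ∈ axisInterval (k + 1))
      (h : q'.1 = (φ k ⟨q.1, hq⟩ : ℝ × ℝ)) : Glue φ q q'

/-- The quotient of the slit disk by the equivalence relation generated by the identifications,
with the quotient topology. -/
abbrev Image (φ : Pairing) : Type := Quot (Glue φ)

/-- The identification map on the slit disk. -/
def identify (φ : Pairing) : slitDisk → Image φ := Quot.mk (Glue φ)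

open Classical in
/-- The function on the square which is `identify φ ∘ h` off the point `p`, and which sends `p`
to the image of `(0,-1)`. -/
noncomputable def kuperbergFun (p : unitSquare) (h : {q : unitSquare // q ≠ p} ≃ₜ slitDisk)
    (φ : Pairing) (q : unitSquare) : Image φ :=
  if hq : q = p then identify φ bottom else identify φ (h ⟨q, hq⟩)

/-- The one-point compactification of `X` with the added point `∞` identified with `c`,
with the quotient topology. -/
abbrev PinchedCompactification (X : Type) [TopologicalSpace X] (c : X) : Type :=
  Quot (fun a b : OnePoint X => a = OnePoint.infty ∧ b = (c : OnePoint X))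

/-- The canonical map of `X` to `PinchedCompactification X c`. -/
def toPinched {X : Type} [TopologicalSpace X] (c : X) (x : X) : PinchedCompactification X c :=
  Quot.mk _ (x : OnePoint X)

end Kuperberg

/-! Inversion about `(-1,0)` turns the disk minus that point into the half-plane `1 ≤ a`. All the
circles pass through the centre of inversion, so they become the lines `a = n`, and the removed
semicircles become the slits `a = n`, `0 ≤ b`. Pushing the slits off to infinity in the `b`
direction (`halfSpaceHomeomorph`) identifies the slit half-plane with the full one, and so with a
punctured disk or square.

In these coordinates the identifications form an involution `partner` with exactly one fixed point.
The fixed point has a singleton fibre, and sending `p` there makes that fibre a pair, so the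
extended map is 2-to-1. A further factor `V`, negated on the face `a = 1`, changes nothing in the
argument and gives the balls of every dimension.

The involution is not continuous, but it reflects in `b` off a closed seam and is continuous on the
seam. Hence the quotient map restricted to the lower half `b ≤ 0` is a proper surjection
(`isProperMap_lowerHalf`). Hausdorffness, second countability and local compactness descend along
it, which gives metrizability, and it shows that the quotient is not compact. Continuity fails at
`p` because sequences approaching different points of a slit all tend to `p` in the source, while
their images have different limits (`not_continuousAt_of_extension`). -/

namespace Kuperberg

set_option linter.unusedSectionVars false

open Filter TopologicalSpace

/-! ### Topological properties that descend along proper surjections. -/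

section ProperSurjection

variable {X Y : Type*} [TopologicalSpace X] [TopologicalSpace Y] {f : X → Y}

/-- Closedness of `f` means that the points whose whole fibre lies in an open set form an open set.
Such sets supply the neighbourhoods needed in `Y`. -/
theorem _root_.IsProperMap.isOpen_kernImage (hf : IsProperMap f) {u : Set X} (hu : IsOpen u) :
    IsOpen (kernImage f u) :=
  isClosedMap_iff_kernImage.1 hf.isClosedMap hu

/-- A Hausdorff space is mapped to a Hausdorff space by a proper surjection. -/
theorem _root_.IsProperMap.t2Space_of_surjective [T2Space X] (hf : IsProperMap f)
    (hs : Function.Surjective f) : T2Space Y := by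
  refine ⟨fun y z hyz => ?_⟩
  have hK : ∀ y, IsCompact (f ⁻¹' {y}) :=
    (isProperMap_iff_isClosedMap_and_compact_fibers.1 hf).2.2
  have hd : Disjoint (f ⁻¹' {y}) (f ⁻¹' {z}) :=
    Disjoint.preimage f (by simpa using hyz)
  obtain ⟨u, v, hu, hv, hyu, hzv, huv⟩ := SeparatedNhds.of_isCompact_isCompact (hK y) (hK z) hd
  refine ⟨_, _, hf.isOpen_kernImage hu, hf.isOpen_kernImage hv, fun x hx => hyu hx,
    fun x hx => hzv hx, Set.disjoint_left.2 fun w hwu hwv => ?_⟩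
  obtain ⟨x, rfl⟩ := hs w
  exact Set.disjoint_left.1 huv (hwu rfl) (hwv rfl)

/-- A second countable space is mapped to a second countable space by a proper surjection. -/
theorem _root_.IsProperMap.secondCountableTopology_of_surjective [SecondCountableTopology X]
    (hf : IsProperMap f) (hs : Function.Surjective f) : SecondCountableTopology Y := by
  have hK : ∀ y, IsCompact (f ⁻¹' {y}) :=
    (isProperMap_iff_isClosedMap_and_compact_fibers.1 hf).2.2
  have hb := isBasis_countableBasis X
  -- A compact fibre inside an open set is covered by finitely many basic sets inside it, so finite
  -- unions suffice, and there are countably many of these.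
  let 𝒞 : Set (Set Y) := (fun F => kernImage f (⋃₀ F)) '' {F | F.Finite ∧ F ⊆ countableBasis X}
  have hc : 𝒞.Countable := (Set.countable_ofPred_finite_subset (countable_countableBasis X)).image _
  refine IsTopologicalBasis.secondCountableTopology (b := 𝒞)
    (isTopologicalBasis_of_isOpen_of_nhds ?_ ?_) hc
  · rintro _ ⟨F, ⟨-, hF⟩, rfl⟩
    exact hf.isOpen_kernImage (isOpen_sUnion fun u hu => hb.isOpen (hF hu))
  · intro y V hy hV
    have hn : ∀ x ∈ f ⁻¹' {y}, ∃ u ∈ countableBasis X, x ∈ u ∧ u ⊆ f ⁻¹' V := fun x hx =>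
      hb.exists_subset_of_mem_open (by rwa [mem_preimage, show f x = y from hx])
        (hV.preimage hf.continuous)
    choose! U hUb hxU hUV using hn
    obtain ⟨t, ht, hyt⟩ := (hK y).elim_nhds_subcover U
      fun x hx => (hb.isOpen (hUb x hx)).mem_nhds (hxU x hx)
    refine ⟨_, ⟨U '' t, ⟨t.finite_toSet.image U, ?_⟩, rfl⟩, ?_, ?_⟩
    · rintro _ ⟨x, hx, rfl⟩
      exact hUb x (ht x hx)
    · intro x hx
      simpa using hyt hx
    · intro z hz
      obtain ⟨x, rfl⟩ := hs z
      obtain ⟨_, ⟨x', hx', rfl⟩, hxx'⟩ := hz rfl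
      exact hUV x' (ht x' hx') hxx'

/-- A weakly locally compact space is mapped to a weakly locally compact space by a proper
surjection. -/
theorem _root_.IsProperMap.weaklyLocallyCompactSpace_of_surjective [WeaklyLocallyCompactSpace X]
    (hf : IsProperMap f) (hs : Function.Surjective f) : WeaklyLocallyCompactSpace Y := by
  refine ⟨fun y => ?_⟩
  obtain ⟨K, hK, hyK⟩ := exists_compact_superset
    ((isProperMap_iff_isClosedMap_and_compact_fibers.1 hf).2.2 y)
  refine ⟨f '' K, hK.image hf.continuous,
    mem_of_superset ((hf.isOpen_kernImage isOpen_interior).mem_nhds fun x hx => hyK hx) ?_⟩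
  intro z hz
  obtain ⟨x, rfl⟩ := hs z
  exact ⟨x, interior_subset (hz rfl), rfl⟩

end ProperSurjection

/-! ### Second countability of the one-point compactification. -/

/-- The one-point compactification of a locally compact second countable Hausdorff space is second
countable. -/
theorem secondCountableTopology_onePoint (X : Type*) [TopologicalSpace X] [T2Space X]
    [LocallyCompactSpace X] [SecondCountableTopology X] : SecondCountableTopology (OnePoint X) := by
  have hb := isBasis_countableBasis X
  let K := CompactExhaustion.choice X
  -- Every compact set lies in some member of the exhaustion, so the complements of its members form
  -- a countable neighbourhood base at `∞`.
  let 𝒞 : Set (Set (OnePoint X)) := (fun u => ((↑) : X → OnePoint X) '' u) '' countableBasis X ∪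
    range fun n => (((↑) : X → OnePoint X) '' K n)ᶜ
  have hc : 𝒞.Countable := ((countable_countableBasis X).image _).union (countable_range _)
  refine IsTopologicalBasis.secondCountableTopology (b := 𝒞)
    (isTopologicalBasis_of_isOpen_of_nhds ?_ ?_) hc
  · rintro _ (⟨u, hu, rfl⟩ | ⟨n, rfl⟩)
    · exact OnePoint.isOpen_image_coe.2 (hb.isOpen hu)
    · exact OnePoint.isOpen_compl_image_coe.2 ⟨(K.isCompact n).isClosed, K.isCompact n⟩
  · intro y V hy hV
    induction y using OnePoint.rec with
    | infty =>
      obtain ⟨hV1, hV2⟩ := (OnePoint.isOpen_iff_of_mem hy).1 hV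
      obtain ⟨n, hn⟩ := K.exists_superset_of_isCompact hV2
      refine ⟨_, Or.inr ⟨n, rfl⟩, by simp, ?_⟩
      intro z hz
      induction z using OnePoint.rec with
      | infty => exact hy
      | coe x =>
        by_contra hx
        exact hz ⟨x, hn hx, rfl⟩
    | coe x =>
      obtain ⟨u, hu, hxu, huV⟩ := hb.exists_subset_of_mem_open (a := x)
        (u := ((↑) : X → OnePoint X) ⁻¹' V) hy (hV.preimage OnePoint.continuous_coe)
      exact ⟨_, Or.inl ⟨u, hu, rfl⟩, ⟨x, hxu, rfl⟩, image_subset_iff.2 huV⟩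

/-! ### Extending a map over one added point. -/

section Extension

variable {X S I : Type*} {p : X} {f : S → I} {F : X → I} {b : S}

theorem surjective_of_extension (h : {q : X // q ≠ p} ≃ S) (hf : Function.Surjective f)
    (hF : ∀ q (hq : q ≠ p), F q = f (h ⟨q, hq⟩)) : Function.Surjective F := by
  intro y
  obtain ⟨s, rfl⟩ := hf y
  exact ⟨h.symm s, by rw [hF _ (h.symm s).2]; simp⟩

/-- If `f` is 2-to-1 except for one point `f b` with only one preimage, then a function which is
`f` up to a bijection off a point `p`, and which takes the value `f b` at `p`, is 2-to-1. -/
theorem isTwoToOne_of_extension (h : {q : X // q ≠ p} ≃ S) (hFp : F p = f b)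
    (hF : ∀ q (hq : q ≠ p), F q = f (h ⟨q, hq⟩)) (hb : f ⁻¹' {f b} = {b})
    (h2 : ∀ s, s ≠ b → (f ⁻¹' {f s}).ncard = 2) : IsTwoToOne F := by
  -- Off `p` the fibres of `F` are bijective copies of those of `f`. Only the singleton fibre over
  -- `f b` gains a point, namely `p`.
  have key : ∀ s, F ⁻¹' {f s} \ {p} = (fun s => (h.symm s : X)) '' (f ⁻¹' {f s}) := by
    intro s
    ext q
    constructor
    · rintro ⟨hq, hqp⟩
      refine ⟨h ⟨q, hqp⟩, ?_, by simp⟩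
      rw [mem_preimage, mem_singleton_iff, ← hF q hqp]
      exact hq
    · rintro ⟨t, ht, rfl⟩
      refine ⟨?_, (h.symm t).2⟩
      rw [mem_preimage, mem_singleton_iff, hF _ (h.symm t).2]
      simpa using ht
  have hinj : Function.Injective fun s => (h.symm s : X) :=
    Subtype.val_injective.comp h.symm.injective
  have aux : ∀ s, (F ⁻¹' {f s}).ncard = 2 := by
    intro s
    by_cases hs : s = b
    · subst hs
      have hp : p ∈ F ⁻¹' {f s} := hFp
      have h1 : F ⁻¹' {f s} = {p, (h.symm s : X)} := by
        rw [← insert_sdiff_self_of_mem hp, key, hb, image_singleton]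
      rw [h1]
      exact ncard_pair (h.symm s).2.symm
    · have hp : p ∉ F ⁻¹' {f s} := by
        intro hp
        have : s ∈ f ⁻¹' {f b} := (hp.symm.trans hFp)
        rw [hb] at this
        exact hs this
      rw [← sdiff_singleton_eq_self hp, key, ncard_image_of_injective _ hinj, h2 s hs]
  rintro _ ⟨q, rfl⟩
  by_cases hq : q = p
  · rw [hq, hFp]
    exact aux b
  · rw [hF q hq]
    exact aux _

variable [TopologicalSpace X] [TopologicalSpace S] [TopologicalSpace I]

theorem continuousAt_of_extension [T1Space X] (h : {q : X // q ≠ p} ≃ₜ S) (hf : Continuous f)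
    (hF : ∀ q (hq : q ≠ p), F q = f (h ⟨q, hq⟩)) {q : X} (hq : q ≠ p) : ContinuousAt F q := by
  have ho : IsOpen {q : X | q ≠ p} := isOpen_ne
  have hc : ContinuousOn F {q : X | q ≠ p} := by
    rw [continuousOn_iff_continuous_domRestrict]
    exact (hf.comp h.continuous).congr fun q => (hF q q.2).symm
  exact hc.continuousAt (ho.mem_nhds hq)

/-- If a sequence leaves every compact subset of the complement of `p`, then its image under a
function continuous at `p` converges to the value at `p`. -/
theorem eq_of_tendsto_of_continuousAt_extension [CompactSpace X] [T2Space X] [T2Space I]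
    (h : {q : X // q ≠ p} ≃ₜ S) (hF : ∀ q (hq : q ≠ p), F q = f (h ⟨q, hq⟩))
    {u : ℕ → S} (hu : Tendsto u atTop (cocompact S)) {y : I}
    (hy : Tendsto (f ∘ u) atTop (𝓝 y)) (hc : ContinuousAt F p) : F p = y := by
  -- The complement of an open neighbourhood of `p` is compact and avoids `p`, so leaving all
  -- compact sets of the punctured space forces convergence to `p`.
  have h1 : Tendsto ((↑) : {q : X // q ≠ p} → X) (cocompact _) (𝓝 p) := by
    intro U hU
    obtain ⟨V, hVU, hV, hpV⟩ := mem_nhds_iff.1 hU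
    refine mem_cocompact.2 ⟨(↑) ⁻¹' Vᶜ, ?_, fun q hq => hVU (by simpa using hq)⟩
    refine (IsInducing.subtypeVal.isCompact_preimage_iff ?_).2 hV.isClosed_compl.isCompact
    intro q hq
    exact ⟨⟨q, fun hqp => hq (hqp ▸ hpV)⟩, rfl⟩
  have h2 : Tendsto (fun n => (h.symm (u n) : X)) atTop (𝓝 p) :=
    h1.comp (h.symm.isClosedEmbedding.tendsto_cocompact.comp hu)
  refine tendsto_nhds_unique (hc.tendsto.comp h2) ?_
  refine hy.congr fun n => ?_
  simp [hF _ (h.symm (u n)).2]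

end Extension

/-! ### The one-point compactification with `∞` glued to a point. -/

section Pinched

variable {X : Type} [TopologicalSpace X] (c : X)

/-- Only the pair `∞`, `c` is related, so the listed alternatives already form an equivalence
relation. -/
theorem pinched_mk_eq_iff {x y : OnePoint X} :
    (Quot.mk _ x : PinchedCompactification X c) = Quot.mk _ y ↔
      x = y ∨ x = OnePoint.infty ∧ y = c ∨ x = c ∧ y = OnePoint.infty := by
  constructor
  · intro h
    have := Quot.eqvGen_exact h
    clear h
    induction this with
    | rel _ _ h => exact Or.inr (Or.inl h)
    | refl _ => exact Or.inl rfl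
    | symm _ _ _ ih =>
      tauto
    | trans _ _ _ h1 h2 ih1 ih2 =>
      rcases ih1 with rfl | ⟨rfl, rfl⟩ | ⟨rfl, rfl⟩ <;> rcases ih2 with rfl | ⟨h, rfl⟩ | ⟨h, rfl⟩ <;>
        simp_all
  · rintro (rfl | ⟨rfl, rfl⟩ | ⟨rfl, rfl⟩)
    · rfl
    · exact Quot.sound ⟨rfl, rfl⟩
    · exact (Quot.sound ⟨rfl, rfl⟩).symm

theorem continuous_toPinched : Continuous (toPinched c) :=
  continuous_quot_mk.comp OnePoint.continuous_coe

theorem toPinched_bijective : Function.Bijective (toPinched c) := by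
  constructor
  · intro x y h
    simpa using (pinched_mk_eq_iff c).1 h
  · intro y
    obtain ⟨x, rfl⟩ := Quot.exists_rep y
    induction x using OnePoint.rec with
    | infty => exact ⟨c, ((pinched_mk_eq_iff c).2 (Or.inr (Or.inl ⟨rfl, rfl⟩))).symm⟩
    | coe x => exact ⟨x, rfl⟩

/-- Saturating a set adds at most the two points `∞` and `c`. Finite sets are closed and compact, so
the projection is closed with compact fibres. -/
theorem isProperMap_pinched_mk [T1Space X] :
    IsProperMap (Quot.mk _ : OnePoint X → PinchedCompactification X c) := by
  have hsat : ∀ s : Set (OnePoint X),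
      (Quot.mk _ : OnePoint X → PinchedCompactification X c) ⁻¹' (Quot.mk _ '' s) ⊆
        s ∪ {OnePoint.infty, (c : OnePoint X)} := by
    rintro s x ⟨y, hy, hxy⟩
    rcases (pinched_mk_eq_iff c).1 hxy with rfl | ⟨-, rfl⟩ | ⟨-, rfl⟩ <;> simp [hy]
  refine isProperMap_iff_isClosedMap_and_compact_fibers.2 ⟨continuous_quot_mk, ?_, ?_⟩
  · intro s hs
    rw [← isQuotientMap_quot_mk.isClosed_preimage]
    have h1 : (Quot.mk _ : OnePoint X → PinchedCompactification X c) ⁻¹' (Quot.mk _ '' s) =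
        s ∪ ((Quot.mk _ : OnePoint X → PinchedCompactification X c) ⁻¹' (Quot.mk _ '' s) ∩
          {OnePoint.infty, (c : OnePoint X)}) := by
      apply Subset.antisymm
      · intro x hx
        exact (hsat s hx).imp id fun h => ⟨hx, h⟩
      · exact union_subset (subset_preimage_image _ _) inter_subset_left
    rw [h1]
    exact hs.union ((toFinite _).subset inter_subset_right).isClosed
  · intro y
    obtain ⟨x, rfl⟩ := Quot.exists_rep y
    rw [← image_singleton]
    exact ((toFinite ({x} ∪ {OnePoint.infty, (c : OnePoint X)})).subset (hsat {x})).isCompact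

theorem metrizableSpace_pinched [T2Space X] [LocallyCompactSpace X] [SecondCountableTopology X] :
    MetrizableSpace (PinchedCompactification X c) := by
  have := secondCountableTopology_onePoint X
  have hp := isProperMap_pinched_mk c
  have := hp.t2Space_of_surjective Quot.mk_surjective
  have := hp.secondCountableTopology_of_surjective Quot.mk_surjective
  exact metrizableSpace_of_t3_secondCountable _

end Pinched

/-! ### Integers as the zeros of the continuous function `sin (π a)`. -/

theorem sin_pi_mul_eq_zero_iff {a : ℝ} : Real.sin (Real.pi * a) = 0 ↔ ∃ n : ℤ, (n : ℝ) = a := by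
  rw [Real.sin_eq_zero_iff]
  refine exists_congr fun n => ?_
  rw [mul_comm (n : ℝ), mul_right_inj' Real.pi_ne_zero]

theorem fract_pos_of_sin_ne_zero {a : ℝ} (ha : Real.sin (Real.pi * a) ≠ 0) : 0 < Int.fract a := by
  refine lt_of_le_of_ne (Int.fract_nonneg a) fun h => ha (sin_pi_mul_eq_zero_iff.2 ⟨⌊a⌋, ?_⟩)
  linarith [Int.self_sub_floor a]

theorem fract_eq_of_lt {a t : ℝ} {n : ℤ} (h : a = n + t) (h0 : 0 ≤ t) (h1 : t < 1) :
    Int.fract a = t := by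
  rw [h, Int.fract_intCast_add, Int.fract_eq_self.2 ⟨h0, h1⟩]

theorem sin_pi_mul_ne_zero_of_lt {a t : ℝ} {n : ℤ} (h : a = n + t) (h0 : 0 < t) (h1 : t < 1) :
    Real.sin (Real.pi * a) ≠ 0 := by
  intro hs
  obtain ⟨m, rfl⟩ := sin_pi_mul_eq_zero_iff.1 hs
  have := fract_eq_of_lt h h0.le h1
  rw [Int.fract_intCast] at this
  exact h0.ne this

theorem div_sub_one_mem_Ioo {b : ℝ} (hb : b < 0) : b / (b - 1) ∈ Ioo (0 : ℝ) 1 := by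
  have h : b - 1 < 0 := by linarith
  refine ⟨div_pos_of_neg_of_neg hb h, ?_⟩
  rw [div_lt_one_of_neg h]
  linarith

/-! ### The slit half-space and its gluing involution. -/

section Model

variable (V : Type*) [NormedAddCommGroup V] [NormedSpace ℝ V]

/-- The half-space `1 ≤ a` of the points `(a, b, v)` with the half-hyperplanes
`a ∈ ℕ, 0 ≤ b` removed. -/
def slitHalfSpace : Set (ℝ × ℝ × V) :=
  {w | 1 ≤ w.1 ∧ (w.2.1 < 0 ∨ Real.sin (Real.pi * w.1) ≠ 0)}

variable {V}

open Classical in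
/-- The other point of the slit half-space in the same class of the identifications. -/
noncomputable def partnerAux (w : ℝ × ℝ × V) : ℝ × ℝ × V :=
  -- A point of fractional part `t` on `b = 0` goes to height `-t/(1-t)` on the next integer wall.
  -- This is a homeomorphism of `(0,1)` onto the negative reals with inverse `b ↦ b/(b-1)`, used in
  -- the third case.
  if w.2.1 = 0 then (w.1 + 1 - Int.fract w.1, - Int.fract w.1 / (1 - Int.fract w.1), w.2.2)
  else if w.1 = 1 then (1, w.2.1⁻¹, -w.2.2)
  else if Real.sin (Real.pi * w.1) = 0 then (w.1 - 1 + w.2.1 / (w.2.1 - 1), 0, w.2.2)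
  else (w.1, -w.2.1, w.2.2)

theorem partnerAux_zero (a : ℝ) (v : V) :
    partnerAux (a, 0, v) = (a + 1 - Int.fract a, - Int.fract a / (1 - Int.fract a), v) := by
  simp [partnerAux]

theorem partnerAux_one {b : ℝ} (hb : b < 0) (v : V) : partnerAux (1, b, v) = (1, b⁻¹, -v) := by
  simp [partnerAux, hb.ne]

theorem partnerAux_int {a b : ℝ} (ha : a ≠ 1) (hs : Real.sin (Real.pi * a) = 0) (hb : b < 0)
    (v : V) : partnerAux (a, b, v) = (a - 1 + b / (b - 1), 0, v) := by
  simp [partnerAux, hb.ne, hs, ha]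

theorem partnerAux_of_ne {a b : ℝ} (hs : Real.sin (Real.pi * a) ≠ 0) (hb : b ≠ 0)
    (v : V) : partnerAux (a, b, v) = (a, -b, v) := by
  have : a ≠ 1 := by rintro rfl; simp at hs
  simp [partnerAux, hb, hs, this]

theorem two_le_of_sin_eq_zero {a : ℝ} (h1 : 1 ≤ a) (ha : a ≠ 1)
    (hs : Real.sin (Real.pi * a) = 0) : 2 ≤ a := by
  obtain ⟨n, rfl⟩ := sin_pi_mul_eq_zero_iff.1 hs
  have h2 : (1 : ℤ) < n := by exact_mod_cast lt_of_le_of_ne h1 ha.symm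
  exact_mod_cast h2

/-- The four kinds of points of the slit half-space. -/
theorem slitHalfSpace_cases {P : ℝ × ℝ × V → Prop} {w : ℝ × ℝ × V} (hw : w ∈ slitHalfSpace V)
    (zero : ∀ a v, 1 ≤ a → Real.sin (Real.pi * a) ≠ 0 → P (a, 0, v))
    (one : ∀ b v, b < 0 → P (1, b, v))
    (int : ∀ a b v, 2 ≤ a → Real.sin (Real.pi * a) = 0 → b < 0 → P (a, b, v))
    (of_ne : ∀ a b v, 1 ≤ a → Real.sin (Real.pi * a) ≠ 0 → b ≠ 0 → P (a, b, v)) : P w := by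
  obtain ⟨a, b, v⟩ := w
  obtain ⟨h1, h2⟩ := hw
  dsimp only at h1 h2
  by_cases hs : Real.sin (Real.pi * a) = 0
  · have hb : b < 0 := h2.resolve_right (not_not.2 hs)
    by_cases ha : a = 1
    · subst ha
      exact one b v hb
    · exact int a b v (two_le_of_sin_eq_zero h1 ha hs) hs hb
  · by_cases hb : b = 0
    · subst hb
      exact zero a v h1 hs
    · exact of_ne a b v h1 hs hb

theorem partnerAux_zero_facts {a : ℝ} (h1 : 1 ≤ a) (hs : Real.sin (Real.pi * a) ≠ 0) :
    2 ≤ a + 1 - Int.fract a ∧ Real.sin (Real.pi * (a + 1 - Int.fract a)) = 0 ∧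
      - Int.fract a / (1 - Int.fract a) < 0 := by
  have h0 := fract_pos_of_sin_ne_zero hs
  have h3 := Int.fract_lt_one a
  have h4 := Int.self_sub_floor a
  have h5 : (1 : ℝ) ≤ ⌊a⌋ := by exact_mod_cast Int.le_floor.2 (by simpa using h1)
  refine ⟨by linarith, sin_pi_mul_eq_zero_iff.2 ⟨⌊a⌋ + 1, by push_cast; linarith⟩, ?_⟩
  exact div_neg_of_neg_of_pos (by linarith) (by linarith)

theorem partnerAux_int_facts {a b : ℝ} (h2 : 2 ≤ a) (hs : Real.sin (Real.pi * a) = 0)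
    (hb : b < 0) : Real.sin (Real.pi * (a - 1 + b / (b - 1))) ≠ 0 ∧
      Int.fract (a - 1 + b / (b - 1)) = b / (b - 1) ∧ 1 ≤ a - 1 + b / (b - 1) := by
  obtain ⟨n, rfl⟩ := sin_pi_mul_eq_zero_iff.1 hs
  have h := div_sub_one_mem_Ioo hb
  have h' : (n : ℝ) - 1 + b / (b - 1) = (n - 1 : ℤ) + b / (b - 1) := by push_cast; ring
  exact ⟨sin_pi_mul_ne_zero_of_lt h' h.1 h.2, fract_eq_of_lt h' h.1.le h.2, by linarith [h.1]⟩

theorem partnerAux_mem {w : ℝ × ℝ × V} (hw : w ∈ slitHalfSpace V) :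
    partnerAux w ∈ slitHalfSpace V := by
  refine slitHalfSpace_cases (P := fun w => partnerAux w ∈ slitHalfSpace V) hw ?_ ?_ ?_ ?_
  · intro a v h1 hs
    have h := partnerAux_zero_facts h1 hs
    rw [partnerAux_zero]
    exact ⟨le_trans one_le_two h.1, Or.inl h.2.2⟩
  · intro b v hb
    rw [partnerAux_one hb]
    exact ⟨le_rfl, Or.inl (inv_lt_zero.2 hb)⟩
  · intro a b v h2 hs hb
    have h := partnerAux_int_facts h2 hs hb
    rw [partnerAux_int (by linarith) hs hb]
    exact ⟨h.2.2, Or.inr h.1⟩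
  · intro a b v h1 hs hb
    rw [partnerAux_of_ne hs hb]
    exact ⟨h1, Or.inr hs⟩

theorem partnerAux_partnerAux {w : ℝ × ℝ × V} (hw : w ∈ slitHalfSpace V) :
    partnerAux (partnerAux w) = w := by
  refine slitHalfSpace_cases (P := fun w => partnerAux (partnerAux w) = w) hw ?_ ?_ ?_ ?_
  · intro a v h1 hs
    have h := partnerAux_zero_facts h1 hs
    have h3 : 1 - Int.fract a ≠ 0 := by linarith [Int.fract_lt_one a]
    rw [partnerAux_zero, partnerAux_int (by linarith) h.2.1 h.2.2]
    refine Prod.ext ?_ rfl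
    have h4 : - Int.fract a / (1 - Int.fract a) - 1 = -1 / (1 - Int.fract a) := by
      field_simp
      ring
    simp only [h4]
    field_simp
    ring
  · intro b v hb
    rw [partnerAux_one hb, partnerAux_one (inv_lt_zero.2 hb), inv_inv, neg_neg]
  · intro a b v h2 hs hb
    have h := partnerAux_int_facts h2 hs hb
    have h3 : b - 1 ≠ 0 := by linarith
    rw [partnerAux_int (by linarith) hs hb, partnerAux_zero, h.2.1]
    have h4 : 1 - b / (b - 1) = -1 / (b - 1) := by
      field_simp
      ring
    rw [h4]
    refine Prod.ext ?_ (Prod.ext ?_ rfl)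
    · dsimp only
      ring
    · dsimp only
      field_simp
  · intro a b v h1 hs hb
    rw [partnerAux_of_ne hs hb, partnerAux_of_ne hs (neg_ne_zero.2 hb), neg_neg]

/-- Only the wall `a = 1` can carry a fixed point, since elsewhere `b` changes. On that wall a fixed
point has `v = -v` and `b² = 1` with `b < 0`, which leaves only `(1,-1,0)`. -/
theorem partnerAux_ne {w : ℝ × ℝ × V} (hw : w ∈ slitHalfSpace V) :
    w ≠ (1, -1, 0) → partnerAux w ≠ w := by
  refine slitHalfSpace_cases (P := fun w => w ≠ (1, -1, 0) → partnerAux w ≠ w) hw ?_ ?_ ?_ ?_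
  · intro a v h1 hs _ he
    rw [partnerAux_zero] at he
    have h := partnerAux_zero_facts h1 hs
    simp only [Prod.mk.injEq] at he
    exact h.2.2.ne he.2.1
  · intro b v hb hne he
    rw [partnerAux_one hb] at he
    simp only [Prod.mk.injEq] at he
    have hv : v = 0 := by
      have h2 : (2 : ℝ) • v = 0 := by
        rw [two_smul]
        nth_rewrite 1 [← he.2.2]
        exact neg_add_cancel v
      exact (smul_eq_zero.1 h2).resolve_left two_ne_zero
    have hb1 : b = -1 := by
      have h1 : b * b = 1 := by
        nth_rewrite 1 [← he.2.1]
        exact inv_mul_cancel₀ hb.ne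
      nlinarith
    exact hne (by rw [hv, hb1])
  · intro a b v h2 hs hb _ he
    rw [partnerAux_int (by linarith) hs hb] at he
    simp only [Prod.mk.injEq] at he
    exact hb.ne he.2.1.symm
  · intro a b v h1 hs hb _ he
    rw [partnerAux_of_ne hs hb] at he
    simp only [Prod.mk.injEq] at he
    exact hb (self_eq_neg.1 he.2.1.symm)

/-- The involution of the slit half-space given by `partnerAux`. -/
noncomputable def partner (w : slitHalfSpace V) : slitHalfSpace V :=
  ⟨partnerAux w, partnerAux_mem w.2⟩

theorem partner_partner (w : slitHalfSpace V) : partner (partner w) = w :=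
  Subtype.ext (partnerAux_partnerAux w.2)

variable (V) in
/-- The fixed point of `partner`. -/
def halfSpaceBottom : slitHalfSpace V := ⟨(1, -1, 0), le_rfl, Or.inl (by norm_num)⟩

theorem partner_ne {w : slitHalfSpace V} (hw : w ≠ halfSpaceBottom V) : partner w ≠ w := fun h =>
  partnerAux_ne w.2 (fun h => hw (Subtype.ext h)) (congrArg Subtype.val h)

theorem partner_bottom : partner (halfSpaceBottom V) = halfSpaceBottom V := by
  refine Subtype.ext ((partnerAux_one (by norm_num) _).trans ?_)
  norm_num [halfSpaceBottom]

variable (V) in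
/-- The part of the slit half-space where `partner` is not a reflection. -/
def seam : Set (slitHalfSpace V) := {w | w.1.2.1 = 0 ∨ Real.sin (Real.pi * w.1.1) = 0}

theorem isClosed_seam : IsClosed (seam V) := by
  apply IsClosed.union
  · exact isClosed_eq (by fun_prop) continuous_const
  · exact isClosed_eq (by fun_prop) continuous_const

/-- The seam is covered by three closed pieces, namely `b = 0`, `a = 1` and the integer walls from
`a = 2` on, and a single formula holds on each. -/
theorem continuousOn_partner_seam : ContinuousOn (partner (V := V)) (seam V) := by
  have hA : IsClosed {w : slitHalfSpace V | w.1.2.1 = 0} :=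
    isClosed_eq (by fun_prop) continuous_const
  have hB : IsClosed {w : slitHalfSpace V | w.1.1 = 1} :=
    isClosed_eq (by fun_prop) continuous_const
  have hC : IsClosed
      ({w : slitHalfSpace V | 2 ≤ w.1.1} ∩ {w | Real.sin (Real.pi * w.1.1) = 0}) :=
    (isClosed_le continuous_const (by fun_prop)).inter
      (isClosed_eq (by fun_prop) continuous_const)
  have hneg : ∀ w : slitHalfSpace V, Real.sin (Real.pi * w.1.1) = 0 → w.1.2.1 < 0 :=
    fun w hs => w.2.2.resolve_right (not_not.2 hs)
  refine ContinuousOn.mono (s := {w : slitHalfSpace V | w.1.2.1 = 0} ∪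
    ({w : slitHalfSpace V | w.1.1 = 1} ∪
      ({w : slitHalfSpace V | 2 ≤ w.1.1} ∩ {w | Real.sin (Real.pi * w.1.1) = 0})))
    (ContinuousOn.union_of_isClosed ?_ (ContinuousOn.union_of_isClosed ?_ ?_ hB hC) hA
      (hB.union hC)) ?_
  · rw [IsInducing.subtypeVal.continuousOn_iff]
    have h1 : ContinuousOn (fun w : slitHalfSpace V => ((w.1.1 + 1 - Int.fract w.1.1,
        - Int.fract w.1.1 / (1 - Int.fract w.1.1), w.1.2.2) : ℝ × ℝ × V))
        {w : slitHalfSpace V | w.1.2.1 = 0} := by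
      -- The slits remove the points of `b = 0` with integral `a`, so the fractional part has no
      -- jump here.
      have hf : ContinuousOn (fun w : slitHalfSpace V => Int.fract w.1.1)
          {w : slitHalfSpace V | w.1.2.1 = 0} := by
        intro w hw
        have hs := w.2.2.resolve_left (by rw [show w.1.2.1 = 0 from hw]; simp)
        have h0 : w.1.1 ≠ ⌊w.1.1⌋ := fun h => hs (sin_pi_mul_eq_zero_iff.2 ⟨_, h.symm⟩)
        exact (ContinuousAt.comp (f := fun w : slitHalfSpace V => w.1.1) (continuousAt_fract h0)
          (by fun_prop)).continuousWithinAt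
      refine ContinuousOn.prodMk (by fun_prop) (ContinuousOn.prodMk ?_ (by fun_prop))
      exact hf.neg.div (continuousOn_const.sub hf) fun w _ => by linarith [Int.fract_lt_one w.1.1]
    refine h1.congr fun w hw => ?_
    change partnerAux (w.1.1, w.1.2.1, w.1.2.2) = _
    rw [show w.1.2.1 = 0 from hw, partnerAux_zero]
  · rw [IsInducing.subtypeVal.continuousOn_iff]
    have h1 : ContinuousOn (fun w : slitHalfSpace V => ((1, (w.1.2.1)⁻¹, -w.1.2.2) : ℝ × ℝ × V))
        {w : slitHalfSpace V | w.1.1 = 1} := by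
      refine ContinuousOn.prodMk (by fun_prop) (ContinuousOn.prodMk ?_ (by fun_prop))
      refine ContinuousOn.inv₀ (by fun_prop) fun w hw => (hneg w ?_).ne
      rw [show w.1.1 = 1 from hw]
      simp
    refine h1.congr fun w hw => ?_
    change partnerAux (w.1.1, w.1.2.1, w.1.2.2) = _
    have : w.1.2.1 < 0 := hneg w (by rw [show w.1.1 = 1 from hw]; simp)
    rw [show w.1.1 = 1 from hw, partnerAux_one this]
  · rw [IsInducing.subtypeVal.continuousOn_iff]
    have h1 : ContinuousOn (fun w : slitHalfSpace V =>
        ((w.1.1 - 1 + w.1.2.1 / (w.1.2.1 - 1), 0, w.1.2.2) : ℝ × ℝ × V))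
        ({w : slitHalfSpace V | 2 ≤ w.1.1} ∩ {w | Real.sin (Real.pi * w.1.1) = 0}) := by
      refine ContinuousOn.prodMk (ContinuousOn.add (by fun_prop)
        (ContinuousOn.div (by fun_prop) (by fun_prop) fun w hw => ?_)) (by fun_prop)
      linarith [hneg w hw.2]
    refine h1.congr fun w hw => ?_
    have h2 : 2 ≤ w.1.1 := hw.1
    exact partnerAux_int (by linarith) hw.2 (hneg w hw.2) _
  · rintro w (hw | hw)
    · exact Or.inl hw
    · by_cases h1 : w.1.1 = 1
      · exact Or.inr (Or.inl h1)
      · exact Or.inr (Or.inr ⟨two_le_of_sin_eq_zero w.2.1 h1 hw, hw⟩)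

/-- The retraction of the slit half-space on its lower half. -/
def fold (w : slitHalfSpace V) : slitHalfSpace V :=
  ⟨(w.1.1, -|w.1.2.1|, w.1.2.2), w.2.1, by
    refine w.2.2.imp (fun h => ?_) id
    exact neg_lt_zero.2 (abs_pos.2 h.ne)⟩

theorem continuous_fold : Continuous (fold (V := V)) :=
  Continuous.subtype_mk (by fun_prop) _

theorem fold_eq_self {w : slitHalfSpace V} (hw : w.1.2.1 ≤ 0) : fold w = w := by
  refine Subtype.ext (Prod.ext rfl (Prod.ext ?_ rfl))
  simp [fold, abs_of_nonpos hw]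

theorem partner_coe_of_notMem_seam {w : slitHalfSpace V} (hw : w ∉ seam V) :
    (partner w : ℝ × ℝ × V) = (w.1.1, -w.1.2.1, w.1.2.2) :=
  partnerAux_of_ne (fun h => hw (Or.inr h)) (fun h => hw (Or.inl h)) _

/-- A point with `b > 0` is never on the seam, so its partner is its reflection. Hence every class
meets the lower half. -/
theorem fold_eq_partner {w : slitHalfSpace V} (hw : 0 < w.1.2.1) : fold w = partner w := by
  have h : w ∉ seam V := by
    rintro (h | h)
    · exact hw.ne' h
    · exact w.2.2.elim (fun h => lt_asymm h hw) fun h' => h' h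
  refine Subtype.ext ?_
  rw [partner_coe_of_notMem_seam h]
  simp [fold, abs_of_pos hw]

end Model

/-! ### Removing the slits up to homeomorphism. -/

section HalfSpace

variable (V : Type*) [NormedAddCommGroup V] [NormedSpace ℝ V]

/-- The half-space `1 ≤ a` of the points `(a, b, v)`. -/
def halfSpace : Set (ℝ × ℝ × V) := {w | 1 ≤ w.1}

/-- Equality to zero would need `sin (π a) = 0` and `b ≥ 0`, which describes exactly the removed
slits. The inverse homeomorphism takes the logarithm of this quantity. -/
theorem sqrt_sub_pos {V : Type*} (w : slitHalfSpace V) :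
    0 < √(w.1.2.1 ^ 2 + Real.sin (Real.pi * w.1.1) ^ 2) - w.1.2.1 := by
  rw [sub_pos]
  rcases w.2.2 with h | h
  · exact h.trans_le (Real.sqrt_nonneg _)
  · exact Real.lt_sqrt_of_sq_lt (lt_add_of_pos_right _ (by positivity))

/-- A homeomorphism of the half-space to the slit half-space that preserves `a` and `v`. -/
noncomputable def halfSpaceHomeomorph : halfSpace V ≃ₜ slitHalfSpace V where
  -- With `s = sin (π a)` and `c = exp b`, the function `c ↦ (s² - c²)/(2c)` is decreasing on `c >
  -- 0`. Its range is all of `ℝ` if `s ≠ 0` and the negative reals if `s = 0`. Solving the quadratic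
  -- for `c` gives `√(b² + s²) - b`, now with `b` the image height.
  toFun w := ⟨(w.1.1, (Real.sin (Real.pi * w.1.1) ^ 2 - Real.exp w.1.2.1 ^ 2) /
      (2 * Real.exp w.1.2.1), w.1.2.2), w.2, by
    by_cases hs : Real.sin (Real.pi * w.1.1) = 0
    · left
      have := Real.exp_pos w.1.2.1
      dsimp only
      rw [hs]
      apply div_neg_of_neg_of_pos
      · nlinarith
      · positivity
    · exact Or.inr hs⟩
  invFun w := ⟨(w.1.1, Real.log (√(w.1.2.1 ^ 2 + Real.sin (Real.pi * w.1.1) ^ 2) - w.1.2.1),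
    w.1.2.2), w.2.1⟩
  left_inv w := by
    refine Subtype.ext (Prod.ext rfl (Prod.ext ?_ rfl))
    dsimp only
    have hc := Real.exp_pos w.1.2.1
    set c := Real.exp w.1.2.1 with hcd
    set s := Real.sin (Real.pi * w.1.1)
    have h1 : ((s ^ 2 - c ^ 2) / (2 * c)) ^ 2 + s ^ 2 = ((s ^ 2 + c ^ 2) / (2 * c)) ^ 2 := by
      field_simp
      ring
    rw [h1, Real.sqrt_sq (by positivity)]
    have h2 : (s ^ 2 + c ^ 2) / (2 * c) - (s ^ 2 - c ^ 2) / (2 * c) = c := by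
      field_simp
      ring
    rw [h2, hcd, Real.log_exp]
  right_inv w := by
    refine Subtype.ext (Prod.ext rfl (Prod.ext ?_ rfl))
    dsimp only
    have hpos := sqrt_sub_pos w
    rw [Real.exp_log hpos]
    rw [div_eq_iff (by positivity)]
    have h := Real.sq_sqrt (x := w.1.2.1 ^ 2 + Real.sin (Real.pi * w.1.1) ^ 2) (by positivity)
    linear_combination (-1 : ℝ) * h
  continuous_toFun := by
    refine Continuous.subtype_mk (.prodMk (by fun_prop) (.prodMk ?_ (by fun_prop))) _
    exact Continuous.div (by fun_prop) (by fun_prop) fun w => by positivity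
  continuous_invFun := by
    refine Continuous.subtype_mk (.prodMk (by fun_prop) (.prodMk ?_ (by fun_prop))) _
    exact Continuous.log (by fun_prop) fun w => (sqrt_sub_pos w).ne'

theorem connectedSpace_slitHalfSpace : ConnectedSpace (slitHalfSpace V) := by
  have hc : Convex ℝ (halfSpace V) :=
    convex_halfSpace_ge (f := fun w : ℝ × ℝ × V => w.1) ⟨fun _ _ => rfl, fun _ _ => rfl⟩ 1
  have : ConnectedSpace (halfSpace V) :=
    isConnected_iff_connectedSpace.1 (hc.isConnected ⟨(1, 0, 0), le_refl (1 : ℝ)⟩)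
  exact (halfSpaceHomeomorph V).surjective.connectedSpace (halfSpaceHomeomorph V).continuous

theorem locallyCompactSpace_slitHalfSpace [LocallyCompactSpace V] :
    LocallyCompactSpace (slitHalfSpace V) := by
  apply IsLocallyClosed.locallyCompactSpace
  have h : slitHalfSpace V = ({w : ℝ × ℝ × V | w.2.1 < 0} ∪
    {w : ℝ × ℝ × V | Real.sin (Real.pi * w.1) ≠ 0}) ∩ {w : ℝ × ℝ × V | 1 ≤ w.1} := by
    ext w
    exact and_comm
  rw [h]
  refine IsOpen.isLocallyClosed ?_ |>.inter (IsClosed.isLocallyClosed ?_)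
  · exact (isOpen_lt (by fun_prop) continuous_const).union (isOpen_ne_fun (by fun_prop)
      continuous_const)
  · exact isClosed_le continuous_const (by fun_prop)

end HalfSpace

/-- A sequence in a subset that converges to a point outside of it leaves the compact subsets. -/
theorem tendsto_cocompact_of_tendsto_notMem {X : Type*} [TopologicalSpace X] [T2Space X]
    {A : Set X} {u : ℕ → A} {x : X} (hx : x ∉ A)
    (hu : Tendsto (fun n => (u n : X)) atTop (𝓝 x)) : Tendsto u atTop (cocompact A) := by
  intro s hs
  obtain ⟨K, hK, hKs⟩ := mem_cocompact.1 hs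
  have hK' : IsCompact ((↑) '' K : Set X) := hK.image continuous_subtype_val
  have hxK : x ∉ ((↑) '' K : Set X) := by
    rintro ⟨y, -, rfl⟩
    exact hx y.2
  change ∀ᶠ n in atTop, u n ∈ s
  filter_upwards [hu.eventually_mem (hK'.isClosed.isOpen_compl.mem_nhds hxK)] with n hn
  exact hKs fun h => hn ⟨_, h, rfl⟩

/-! ### The quotient by the involution. -/

section Quotient

variable {V : Type*} [NormedAddCommGroup V] [NormedSpace ℝ V]
  {Y : Type*} {f : slitHalfSpace V → Y} (hfib : ∀ w z, f z = f w ↔ z = w ∨ z = partner w)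

include hfib

theorem preimage_image_eq_pair (w : slitHalfSpace V) : f ⁻¹' {f w} = {w, partner w} :=
  Set.ext fun z => hfib w z

theorem preimage_image_bottom : f ⁻¹' {f (halfSpaceBottom V)} = {halfSpaceBottom V} := by
  rw [preimage_image_eq_pair hfib, partner_bottom, pair_eq_singleton]

theorem ncard_preimage_image {w : slitHalfSpace V} (hw : w ≠ halfSpaceBottom V) :
    (f ⁻¹' {f w}).ncard = 2 := by
  rw [preimage_image_eq_pair hfib]
  exact ncard_pair (partner_ne hw).symm

theorem apply_fold (w : slitHalfSpace V) : f (fold w) = f w := by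
  rw [hfib]
  rcases le_or_gt w.1.2.1 0 with h | h
  · exact Or.inl (fold_eq_self h)
  · exact Or.inr (fold_eq_partner h)

theorem surjective_lowerHalf (hs : Function.Surjective f) :
    Function.Surjective fun w : {w : slitHalfSpace V | w.1.2.1 ≤ 0} => f w := by
  intro y
  obtain ⟨w, rfl⟩ := hs y
  exact ⟨⟨fold w, neg_nonpos.2 (abs_nonneg w.1.2.1)⟩, apply_fold hfib w⟩

variable [TopologicalSpace Y]

/-- Two distinct points of the lower half are identified only along the seam, since off it the
partner is the reflection. There `partner` is continuous, so saturations of closed sets stay closed.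
Fibres are finite. -/
theorem isProperMap_lowerHalf (hf : IsQuotientMap f) :
    IsProperMap fun w : {w : slitHalfSpace V | w.1.2.1 ≤ 0} => f w := by
  have hT : IsClosed {w : slitHalfSpace V | w.1.2.1 ≤ 0} :=
    isClosed_le (by fun_prop) continuous_const
  refine isProperMap_iff_isClosedMap_and_compact_fibers.2
    ⟨hf.continuous.comp continuous_subtype_val, ?_, ?_⟩
  · intro C hC
    have hD : IsClosed ((↑) '' C : Set (slitHalfSpace V)) := hT.isClosedEmbedding_subtypeVal.isClosedMap C hC
    have hE := continuousOn_partner_seam.preimage_isClosed_of_isClosed isClosed_seam hD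
    rw [← hf.isClosed_preimage]
    -- The saturation of `D` is the preimage under `fold` of `D` together with the seam points whose
    -- partner is in `D`.
    convert (hD.union hE).preimage (continuous_fold (V := V)) using 1
    ext w
    have hw0 : (fold w).1.2.1 ≤ 0 := neg_nonpos.2 (abs_nonneg _)
    rw [mem_preimage, ← apply_fold hfib, mem_preimage]
    constructor
    · rintro ⟨d, hd, hdw⟩
      rcases (hfib _ _).1 hdw with h | h
      · exact Or.inl ⟨d, hd, h⟩
      · by_cases hs : fold w ∈ seam V
        · exact Or.inr ⟨hs, d, hd, h⟩
        · have h1 := partner_coe_of_notMem_seam hs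
          rw [← h] at h1
          have h2 : d.1.1.2.1 = -(fold w).1.2.1 := by rw [h1]
          have h3 : d.1.1.2.1 ≤ 0 := d.2
          exact (hs (Or.inl (by linarith))).elim
    · rintro (⟨d, hd, h⟩ | ⟨-, d, hd, h⟩)
      · exact ⟨d, hd, congrArg f h⟩
      · exact ⟨d, hd, (hfib _ _).2 (Or.inr h)⟩
  · intro y
    refine Set.Finite.isCompact ?_
    obtain ⟨w, rfl⟩ := hf.surjective y
    refine Set.Finite.subset (Set.Finite.preimage Subtype.val_injective.injOn
      (toFinite {w, partner w})) fun z hz => ?_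
    exact (hfib _ _).1 hz

theorem metrizableSpace_and_locallyCompactSpace_of_isQuotientMap [LocallyCompactSpace V]
    [SecondCountableTopology V] (hf : IsQuotientMap f) :
    T2Space Y ∧ SecondCountableTopology Y ∧ MetrizableSpace Y ∧ LocallyCompactSpace Y := by
  have hp := isProperMap_lowerHalf hfib hf
  have hs := surjective_lowerHalf hfib hf.surjective
  have := locallyCompactSpace_slitHalfSpace V
  have hT : IsClosed {w : slitHalfSpace V | w.1.2.1 ≤ 0} :=
    isClosed_le (by fun_prop) continuous_const
  have := hT.isClosedEmbedding_subtypeVal.locallyCompactSpace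
  have := hp.t2Space_of_surjective hs
  have := hp.secondCountableTopology_of_surjective hs
  have := hp.weaklyLocallyCompactSpace_of_surjective hs
  exact ⟨inferInstance, inferInstance, metrizableSpace_of_t3_secondCountable _, inferInstance⟩

/-- Properness would make the lower half compact, but `a` is unbounded on it. -/
theorem noncompactSpace_of_isQuotientMap (hf : IsQuotientMap f) : NoncompactSpace Y := by
  rw [← not_compactSpace_iff]
  intro _
  have h := (isProperMap_lowerHalf hfib hf).isCompact_preimage isCompact_univ
  rw [preimage_univ] at h
  have h1 := h.image (f := fun w : {w : slitHalfSpace V | w.1.2.1 ≤ 0} => w.1.1.1) (by fun_prop)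
  obtain ⟨M, hM⟩ := h1.bddAbove
  have hm : max 1 (M + 1) ≤ M := hM
    ⟨⟨⟨(max 1 (M + 1), -1, 0), le_max_left _ _, Or.inl (by norm_num)⟩, by norm_num⟩, mem_univ _, rfl⟩
  linarith [le_max_right 1 (M + 1)]

/-- The points of the lower half that are limits of the images of sequences in the slit half-space
without accumulation points. -/
theorem exists_tendsto_cocompact (hf : Continuous f) {s : ℝ} (hs : 0 < s) :
    ∃ u : ℕ → slitHalfSpace V, Tendsto u atTop (cocompact _) ∧
      Tendsto (f ∘ u) atTop (𝓝 (f ⟨(2, -s, 0), one_le_two, Or.inl (neg_lt_zero.2 hs)⟩)) := by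
  have hlt : ∀ n : ℕ, 1 / ((n : ℝ) + 1 + 1) < 1 := fun n => by
    rw [div_lt_one (by positivity)]
    linarith [n.cast_nonneg (α := ℝ)]
  have hpos : ∀ n : ℕ, 0 < 1 / ((n : ℝ) + 1 + 1) := fun n => by positivity
  -- The points approach `(2, s, 0)` on the second slit from the left. The shift to `n + 2` keeps
  -- `a` strictly between `1` and `2`.
  let u : ℕ → slitHalfSpace V := fun n => ⟨(2 - 1 / ((n : ℝ) + 1 + 1), s, 0), by
    change (1 : ℝ) ≤ 2 - 1 / ((n : ℝ) + 1 + 1)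
    linarith [hlt n], Or.inr (sin_pi_mul_ne_zero_of_lt (n := 1)
      (t := 1 - 1 / ((n : ℝ) + 1 + 1)) (by push_cast; ring) (by linarith [hlt n])
      (by linarith [hpos n]))⟩
  have h1 : Tendsto (fun n : ℕ => (2 : ℝ) - 1 / ((n : ℝ) + 1 + 1)) atTop (𝓝 2) := by
    have := (tendsto_one_div_add_atTop_nhds_zero_nat (𝕜 := ℝ)).comp (tendsto_add_atTop_nat 1)
    simpa using this.const_sub 2
  have h2 : Tendsto (fun n => (u n : ℝ × ℝ × V)) atTop (𝓝 (2, s, 0)) :=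
    h1.prodMk_nhds tendsto_const_nhds
  refine ⟨u, tendsto_cocompact_of_tendsto_notMem ?_ h2, ?_⟩
  · rintro ⟨-, h | h⟩
    · exact lt_asymm h hs
    · exact h (sin_pi_mul_eq_zero_iff.2 ⟨2, by norm_num⟩)
  -- Reflection does not change the image under `f`, and below the slit the limit point is present.
  · have h3 : Tendsto (fun n => fold (u n)) atTop
        (𝓝 ⟨(2, -s, 0), one_le_two, Or.inl (neg_lt_zero.2 hs)⟩) := by
      rw [tendsto_subtype_rng]
      refine h1.prodMk_nhds (Tendsto.congr (fun n => ?_) tendsto_const_nhds)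
      simp [u, abs_of_pos hs]
    exact ((hf.tendsto _).comp h3).congr fun n => apply_fold hfib (u n)

/-- Continuity would force `F p` to equal the image of `(2,-s,0)` for every `s > 0`. The values `s =
1` and `s = 2` give points in different classes, as the partner of `(2,-2,0)` has `b = 0`. -/
theorem not_continuousAt_of_extension {X : Type*} [TopologicalSpace X] [CompactSpace X]
    [T2Space X] [T2Space Y] {p : X} (h : {q : X // q ≠ p} ≃ₜ slitHalfSpace V) {F : X → Y}
    (hf : Continuous f) (hF : ∀ q (hq : q ≠ p), F q = f (h ⟨q, hq⟩)) : ¬ ContinuousAt F p := by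
  intro hc
  have key : ∀ s : ℝ, ∀ hs : 0 < s,
      F p = f ⟨(2, -s, 0), one_le_two, Or.inl (neg_lt_zero.2 hs)⟩ := by
    intro s hs
    obtain ⟨u, hu, hu'⟩ := exists_tendsto_cocompact hfib hf hs
    exact eq_of_tendsto_of_continuousAt_extension h hF hu hu' hc
  have he := (key 1 one_pos).symm.trans (key 2 two_pos)
  rcases (hfib _ _).1 he with h | h
  · have : (-1 : ℝ) = -2 := congrArg (fun w => w.1.2.1) h
    norm_num at this
  · have h1 := congrArg (fun w => w.1.2.1) h
    have h2 : partnerAux ((2 : ℝ), (-2 : ℝ), (0 : V)) = _ := partnerAux_int (by norm_num)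
      (sin_pi_mul_eq_zero_iff.2 ⟨2, by norm_num⟩) (by norm_num) 0
    have h3 : (-1 : ℝ) = (partnerAux ((2 : ℝ), (-2 : ℝ), (0 : V))).2.1 := h1
    rw [h2] at h3
    norm_num at h3

end Quotient

/-! ### Inversion between the punctured ball and the half-space. -/

section Inversion

variable {V : Type*} [NormedAddCommGroup V] [NormedSpace ℝ V]

/-- The square of the Euclidean norm on `ℝ × ℝ × V`. -/
def sqNorm (u : ℝ × ℝ × V) : ℝ := u.1 ^ 2 + u.2.1 ^ 2 + ‖u.2.2‖ ^ 2

theorem sqNorm_pos {u : ℝ × ℝ × V} (hu : u ≠ 0) : 0 < sqNorm u := by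
  by_contra! h
  unfold sqNorm at h
  have h1 := sq_nonneg u.1
  have h2 := sq_nonneg u.2.1
  have h3 := sq_nonneg ‖u.2.2‖
  have h1' : u.1 ^ 2 = 0 := by linarith
  have h2' : u.2.1 ^ 2 = 0 := by linarith
  have h3' : ‖u.2.2‖ ^ 2 = 0 := by linarith
  exact hu (Prod.ext (pow_eq_zero_iff two_ne_zero |>.1 h1') (Prod.ext
    (pow_eq_zero_iff two_ne_zero |>.1 h2') (norm_eq_zero.1 (pow_eq_zero_iff two_ne_zero |>.1 h3'))))

theorem continuous_sqNorm : Continuous (sqNorm (V := V)) := by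
  unfold sqNorm
  fun_prop

/-- The inversion in the sphere of radius `√2` about the origin. -/
noncomputable def invert (u : ℝ × ℝ × V) : ℝ × ℝ × V := (2 / sqNorm u) • u

theorem invert_fst (u : ℝ × ℝ × V) : (invert u).1 = 2 / sqNorm u * u.1 := rfl

theorem invert_snd_fst (u : ℝ × ℝ × V) : (invert u).2.1 = 2 / sqNorm u * u.2.1 := rfl

theorem sqNorm_invert {u : ℝ × ℝ × V} (hu : u ≠ 0) : sqNorm (invert u) = 4 / sqNorm u := by
  have h := sqNorm_pos hu
  have h1 : sqNorm (invert u) = (2 / sqNorm u) ^ 2 * sqNorm u := by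
    simp only [sqNorm, invert, Prod.smul_fst, Prod.smul_snd, smul_eq_mul, norm_smul, mul_pow,
      Real.norm_eq_abs, sq_abs]
    ring
  rw [h1]
  field_simp
  norm_num

theorem invert_ne_zero {u : ℝ × ℝ × V} (hu : u ≠ 0) : invert u ≠ 0 :=
  smul_ne_zero (div_pos two_pos (sqNorm_pos hu)).ne' hu

theorem invert_invert {u : ℝ × ℝ × V} (hu : u ≠ 0) : invert (invert u) = u := by
  have h := sqNorm_pos hu
  rw [invert, sqNorm_invert hu, invert, smul_smul]
  have h1 : 2 / (4 / sqNorm u) * (2 / sqNorm u) = 1 := by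
    field_simp
    norm_num
  rw [h1, one_smul]

theorem continuous_invert_comp {X : Type*} [TopologicalSpace X] {g : X → ℝ × ℝ × V}
    (hg : Continuous g) (h0 : ∀ x, g x ≠ 0) : Continuous fun x => invert (g x) :=
  (continuous_const.div (continuous_sqNorm.comp hg) fun x => (sqNorm_pos (h0 x)).ne').smul hg

variable (V) in
/-- The closed Euclidean unit ball of `ℝ × ℝ × V`. -/
def solidBall : Set (ℝ × ℝ × V) := {q | sqNorm q ≤ 1}

variable (V) in
/-- The point `(-1, 0, 0)` of the unit ball. -/
def pole : solidBall V := ⟨(-1, 0, 0), by simp [solidBall, sqNorm]⟩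

/-- Moving the pole to the origin puts the ball in the form `|u|² ≤ 2u₁`, which inversion of power
`2` turns into `1 ≤ a`. -/
theorem sqNorm_add_le_iff (q : ℝ × ℝ × V) :
    sqNorm (q + (1, 0, 0)) ≤ 2 * (q + (1, 0, 0)).1 ↔ sqNorm q ≤ 1 := by
  simp only [sqNorm, Prod.fst_add, Prod.snd_add, add_zero]
  constructor <;> intro h <;> nlinarith

theorem add_ne_zero_of_ne_pole {q : solidBall V} (hq : q ≠ pole V) :
    (q : ℝ × ℝ × V) + (1, 0, 0) ≠ 0 := by
  intro h
  refine hq (Subtype.ext ((eq_neg_of_add_eq_zero_left h).trans ?_))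
  simp [pole]

theorem one_le_invert_fst_iff {u : ℝ × ℝ × V} (hu : u ≠ 0) :
    1 ≤ (invert u).1 ↔ sqNorm u ≤ 2 * u.1 := by
  rw [invert_fst, div_mul_eq_mul_div, one_le_div (sqNorm_pos hu)]

theorem ne_zero_of_one_le {w : ℝ × ℝ × V} (hw : 1 ≤ w.1) : w ≠ 0 := by
  rintro rfl
  exact absurd hw (by simp)

theorem invert_sub_mem_solidBall {w : ℝ × ℝ × V} (hw : 1 ≤ w.1) :
    invert w - (1, 0, 0) ∈ solidBall V := by
  have h0 := ne_zero_of_one_le hw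
  have := sqNorm_add_le_iff (invert w - (1, 0, 0))
  rw [sub_add_cancel] at this
  exact this.1 ((one_le_invert_fst_iff (invert_ne_zero h0)).1 (by rwa [invert_invert h0]))

variable (V) in
/-- The inversion about `(-1, 0, 0)` as a homeomorphism of the punctured ball to the half-space. -/
noncomputable def puncturedBallHomeomorph : {q : solidBall V // q ≠ pole V} ≃ₜ halfSpace V where
  toFun q := ⟨invert ((q : ℝ × ℝ × V) + (1, 0, 0)),
    (one_le_invert_fst_iff (add_ne_zero_of_ne_pole q.2)).2 ((sqNorm_add_le_iff _).2 q.1.2)⟩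
  invFun w := ⟨⟨invert (w : ℝ × ℝ × V) - (1, 0, 0), invert_sub_mem_solidBall w.2⟩, fun h => by
    refine invert_ne_zero (ne_zero_of_one_le w.2) ?_
    have h1 : invert (w : ℝ × ℝ × V) - (1, 0, 0) = (-1, 0, 0) := congrArg Subtype.val h
    rw [sub_eq_iff_eq_add.1 h1]
    simp⟩
  left_inv q := by
    refine Subtype.ext (Subtype.ext ?_)
    simp only
    rw [invert_invert (add_ne_zero_of_ne_pole q.2), add_sub_cancel_right]
  right_inv w := by
    refine Subtype.ext ?_
    simp only
    rw [sub_add_cancel, invert_invert (ne_zero_of_one_le w.2)]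
  continuous_toFun := Continuous.subtype_mk (continuous_invert_comp (by fun_prop)
    fun q => add_ne_zero_of_ne_pole q.2) _
  continuous_invFun := Continuous.subtype_mk (Continuous.subtype_mk ((continuous_invert_comp
    (by fun_prop) fun w => ne_zero_of_one_le w.2).sub continuous_const) _) _

end Inversion

/-! ### The planar arcs and intervals in inverted coordinates. -/

section Plane

/-- The plane as the subspace `(x + 1, y, 0)` of `ℝ × ℝ × V`. -/
def shift (V : Type*) [NormedAddCommGroup V] (s : ℝ × ℝ) : ℝ × ℝ × V := (s.1 + 1, s.2, 0)

variable {V : Type*} [NormedAddCommGroup V] [NormedSpace ℝ V]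

theorem sqNorm_shift (s : ℝ × ℝ) : sqNorm (shift V s) = (s.1 + 1) ^ 2 + s.2 ^ 2 := by
  simp [sqNorm, shift]

theorem continuous_shift : Continuous (shift V) := by
  unfold shift
  fun_prop

/-- With the origin moved to `(-1,0)`, the circle has equation `n|u|² = 2u₁`, so it inverts to a
line. -/
theorem circle_iff {s : ℝ × ℝ} (hs : shift V s ≠ 0) {n : ℕ} (hn : 1 ≤ n) :
    (s.1 + ((n : ℝ) - 1) / n) ^ 2 + s.2 ^ 2 = 1 / (n : ℝ) ^ 2 ↔ (invert (shift V s)).1 = n := by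
  have hn0 : (0 : ℝ) < n := by exact_mod_cast hn
  have hN := sqNorm_pos hs
  rw [invert_fst, div_mul_eq_mul_div, div_eq_iff hN.ne', sqNorm_shift, shift]
  have h1 : (s.1 + ((n : ℝ) - 1) / n) ^ 2 + s.2 ^ 2 - 1 / (n : ℝ) ^ 2 =
      (n * ((s.1 + 1) ^ 2 + s.2 ^ 2) - 2 * (s.1 + 1)) / n := by
    field_simp
    ring
  rw [← sub_eq_zero, h1, div_eq_zero_iff, or_iff_left hn0.ne', sub_eq_zero, eq_comm]

theorem invert_shift_snd_nonneg_iff {s : ℝ × ℝ} (hs : shift V s ≠ 0) :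
    0 ≤ (invert (shift V s)).2.1 ↔ 0 ≤ s.2 := by
  rw [invert_snd_fst, mul_nonneg_iff_of_pos_left (div_pos two_pos (sqNorm_pos hs))]
  rfl

theorem invert_shift_snd_pos_iff {s : ℝ × ℝ} (hs : shift V s ≠ 0) :
    0 < (invert (shift V s)).2.1 ↔ 0 < s.2 := by
  rw [invert_snd_fst, mul_pos_iff_of_pos_left (div_pos two_pos (sqNorm_pos hs))]
  rfl

theorem invert_shift_snd_eq_zero_iff {s : ℝ × ℝ} (hs : shift V s ≠ 0) :
    (invert (shift V s)).2.1 = 0 ↔ s.2 = 0 := by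
  rw [invert_snd_fst, mul_eq_zero, or_iff_right (div_pos two_pos (sqNorm_pos hs)).ne']
  rfl

theorem mem_semicircle_iff {s : ℝ × ℝ} (hs : shift V s ≠ 0) {n : ℕ} (hn : 1 ≤ n) :
    s ∈ semicircle n ↔ (invert (shift V s)).1 = n ∧ 0 ≤ (invert (shift V s)).2.1 := by
  rw [invert_shift_snd_nonneg_iff hs, ← circle_iff hs hn]
  rfl

theorem mem_lowerArc_iff {s : ℝ × ℝ} (hs : shift V s ≠ 0) {n : ℕ} (hn : 1 ≤ n) :
    s ∈ lowerArc n ↔ (invert (shift V s)).1 = n ∧ (invert (shift V s)).2.1 < 0 := by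
  rw [← not_le, invert_shift_snd_nonneg_iff hs, ← circle_iff hs hn, not_le]
  rfl

/-- On the axis the inversion is `u ↦ 2/u`, and the interval has ends `2/(n+1)` and `2/n` in the
shifted coordinate. -/
theorem mem_axisInterval_iff {s : ℝ × ℝ} (hs : shift V s ≠ 0) {n : ℕ} (hn : 1 ≤ n) :
    s ∈ axisInterval n ↔ ((n : ℝ) < (invert (shift V s)).1 ∧ (invert (shift V s)).1 < n + 1) ∧
      (invert (shift V s)).2.1 = 0 := by
  have hn0 : (0 : ℝ) < n := by exact_mod_cast hn
  rw [invert_shift_snd_eq_zero_iff hs, axisInterval, mem_ofPred_eq, ← and_assoc]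
  refine and_congr_left fun h0 => ?_
  have hN := sqNorm_pos hs
  rw [sqNorm_shift, h0] at hN
  have hu : s.1 + 1 ≠ 0 := by
    intro h
    simp [h] at hN
  have h1 : (invert (shift V s)).1 = 2 / (s.1 + 1) := by
    rw [invert_fst, sqNorm_shift, h0, shift]
    field_simp
    simp
  have h2 : (1 - (n : ℝ)) / (n + 1) = 2 / (n + 1) - 1 := by field_simp; ring
  have h3 : (2 - (n : ℝ)) / n = 2 / n - 1 := by field_simp
  rw [h1, h2, h3, sub_lt_iff_lt_add, lt_sub_iff_add_lt]
  rcases lt_or_gt_of_ne hu with h | h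
  · have h4 : 2 / (s.1 + 1) < 0 := div_neg_of_pos_of_neg two_pos h
    constructor
    · rintro ⟨h5, -⟩
      have : 0 < 2 / ((n : ℝ) + 1) := by positivity
      linarith
    · rintro ⟨h5, -⟩
      linarith
  · rw [div_lt_iff₀ (by positivity), lt_div_iff₀ hn0, lt_div_iff₀ h, div_lt_iff₀ h, and_comm,
      mul_comm (n : ℝ), mul_comm ((n : ℝ) + 1)]

theorem shift_ne_zero_of_ne {s : ℝ × ℝ} (hs : s ≠ (-1, 0)) : shift V s ≠ 0 := by
  intro h
  simp only [shift, Prod.mk_eq_zero] at h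
  exact hs (Prod.ext (by linarith [h.1]) h.2.1)

/-- The centre of inversion `(-1,0)` is an endpoint of the first removed semicircle. -/
theorem shift_ne_zero {s : ℝ × ℝ} (hs : s ∈ slitDisk) : shift V s ≠ 0 := by
  refine shift_ne_zero_of_ne ?_
  rintro rfl
  refine hs.2 (mem_iUnion₂.2 ⟨1, le_rfl, ?_, le_rfl⟩)
  norm_num

theorem sq_add_sq_le_one_iff {s : ℝ × ℝ} (hs : shift V s ≠ 0) :
    s.1 ^ 2 + s.2 ^ 2 ≤ 1 ↔ 1 ≤ (invert (shift V s)).1 := by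
  rw [one_le_invert_fst_iff hs, sqNorm_shift, shift]
  constructor <;> intro h <;> nlinarith

theorem mem_slitDisk_iff {s : ℝ × ℝ} (hs : shift V s ≠ 0) :
    s ∈ slitDisk ↔ invert (shift V s) ∈ slitHalfSpace V := by
  change (s.1 ^ 2 + s.2 ^ 2 ≤ 1 ∧ _) ↔ (1 ≤ (invert (shift V s)).1 ∧ _)
  rw [sq_add_sq_le_one_iff hs]
  refine and_congr_right fun h1 => ?_
  rw [mem_iUnion₂, not_exists]
  constructor
  · intro h
    by_contra! h2
    obtain ⟨n, hn⟩ := sin_pi_mul_eq_zero_iff.1 h2.2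
    have hn1 : 1 ≤ n := by rw [← hn] at h1; exact_mod_cast h1
    lift n to ℕ using by omega
    exact h n ⟨by omega, (mem_semicircle_iff hs (by omega)).2 ⟨by rw [← hn]; simp, h2.1⟩⟩
  · rintro h n ⟨hn, hsn⟩
    rw [mem_semicircle_iff hs hn] at hsn
    refine h.elim (fun h => h.not_ge hsn.2) fun h => h (sin_pi_mul_eq_zero_iff.2 ⟨n, ?_⟩)
    rw [hsn.1]
    simp

/-- The point of the plane with a given image under `shift`. -/
def unshift (u : ℝ × ℝ × V) : ℝ × ℝ := (u.1 - 1, u.2.1)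

theorem unshift_shift (s : ℝ × ℝ) : unshift (shift V s) = s := by
  simp [unshift, shift]

theorem shift_unshift [Subsingleton V] (u : ℝ × ℝ × V) : shift V (unshift u) = u := by
  refine Prod.ext ?_ (Prod.ext rfl (Subsingleton.elim _ _))
  simp [unshift, shift]

variable (V) in
/-- The inversion about `(-1, 0)` as a homeomorphism of the slit disk to the slit half-plane. -/
noncomputable def slitDiskHomeomorph [Subsingleton V] : slitDisk ≃ₜ slitHalfSpace V where
  toFun s := ⟨invert (shift V s), (mem_slitDisk_iff (shift_ne_zero s.2)).1 s.2⟩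
  invFun w := ⟨unshift (invert (w : ℝ × ℝ × V)), by
    have h0 := ne_zero_of_one_le w.2.1
    have h1 : shift V (unshift (invert (w : ℝ × ℝ × V))) ≠ 0 := by
      rw [shift_unshift]
      exact invert_ne_zero h0
    rw [mem_slitDisk_iff h1, shift_unshift, invert_invert h0]
    exact w.2⟩
  left_inv s := by
    refine Subtype.ext ?_
    simp only
    rw [invert_invert (shift_ne_zero s.2), unshift_shift]
  right_inv w := by
    refine Subtype.ext ?_
    simp only
    rw [shift_unshift, invert_invert (ne_zero_of_one_le w.2.1)]
  continuous_toFun := Continuous.subtype_mk (continuous_invert_comp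
    (continuous_shift.comp continuous_subtype_val) fun s => shift_ne_zero s.2) _
  continuous_invFun := by
    have h := continuous_invert_comp (g := fun w : slitHalfSpace V => (w : ℝ × ℝ × V))
      continuous_subtype_val fun w => ne_zero_of_one_le w.2.1
    exact Continuous.subtype_mk ((h.fst.sub continuous_const).prodMk h.snd.fst) _

theorem lowerArc_subset_slitDisk {n : ℕ} (hn : 1 ≤ n) : lowerArc n ⊆ slitDisk := by
  intro s hs
  -- Any `V` would serve here, since the third coordinate is zero.
  have h0 : shift ℝ s ≠ 0 := shift_ne_zero_of_ne fun h => by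
    rw [h] at hs
    exact lt_irrefl _ hs.2
  rw [mem_slitDisk_iff h0]
  rw [mem_lowerArc_iff h0 hn] at hs
  exact ⟨by rw [hs.1]; exact_mod_cast hn, Or.inl hs.2⟩

theorem axisInterval_subset_slitDisk {n : ℕ} (hn : 1 ≤ n) : axisInterval n ⊆ slitDisk := by
  intro s hs
  have hn1 : (1 : ℝ) ≤ n := by exact_mod_cast hn
  have h0 : shift ℝ s ≠ 0 := shift_ne_zero_of_ne fun h => by
    have h1 := hs.1
    rw [h, div_lt_iff₀ (by positivity)] at h1
    linarith
  rw [mem_slitDisk_iff h0]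
  rw [mem_axisInterval_iff h0 hn] at hs
  refine ⟨hn1.trans hs.1.1.le, Or.inr (sin_pi_mul_ne_zero_of_lt (n := n)
    (t := (invert (shift ℝ s)).1 - n) (by push_cast; ring) (by linarith) (by linarith))⟩

end Plane

/-! ### The prescribed identifications agree with the involution. -/

section Gluing

variable (V : Type*) [NormedAddCommGroup V] [NormedSpace ℝ V] [Subsingleton V]

/-- The involution of the slit disk that corresponds to `partner`. -/
noncomputable def diskPartner (s : slitDisk) : slitDisk :=
  (slitDiskHomeomorph V).symm (partner (slitDiskHomeomorph V s))

theorem diskPartner_diskPartner (s : slitDisk) : diskPartner V (diskPartner V s) = s := by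
  simp [diskPartner, partner_partner]

variable {V}

theorem slitDiskHomeomorph_mem_seam {s : slitDisk} {k : ℕ}
    (hs : s.1 ∈ axisInterval (k + 1) ∪ lowerArc (k + 2)) :
    slitDiskHomeomorph V s ∈ seam V := by
  have h0 := shift_ne_zero (V := V) s.2
  rcases hs with hs | hs
  · exact Or.inl ((mem_axisInterval_iff h0 (by omega)).1 hs).2
  · refine Or.inr (sin_pi_mul_eq_zero_iff.2 ⟨(k + 2 : ℕ), ?_⟩)
    exact (Int.cast_natCast _).trans ((mem_lowerArc_iff h0 (by omega)).1 hs).1.symm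

theorem slitDiskHomeomorph_diskPartner (s : slitDisk) :
    (invert (shift V (diskPartner V s)) : ℝ × ℝ × V) = partnerAux (invert (shift V s)) := by
  have : slitDiskHomeomorph V (diskPartner V s) = partner (slitDiskHomeomorph V s) := by
    simp [diskPartner]
  exact congrArg Subtype.val this

theorem eq_coords_of_subsingleton (w : ℝ × ℝ × V) : w = (w.1, w.2.1, 0) :=
  Prod.ext rfl (Prod.ext rfl (Subsingleton.elim _ _))

theorem diskPartner_mem_lowerArc {s : slitDisk} {k : ℕ} (hs : s.1 ∈ axisInterval (k + 1)) :
    (diskPartner V s : ℝ × ℝ) ∈ lowerArc (k + 2) := by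
  have h := (mem_axisInterval_iff (shift_ne_zero (V := V) s.2) (by omega)).1 hs
  rw [mem_lowerArc_iff (shift_ne_zero (V := V) (diskPartner V s).2) (by omega),
    slitDiskHomeomorph_diskPartner, eq_coords_of_subsingleton (invert _), h.2, partnerAux_zero]
  set a := (invert (shift V s)).1
  obtain ⟨⟨h1, h2⟩, -⟩ := h
  push_cast at h1 h2
  have h3 : Int.fract a = a - (k + 1) :=
    fract_eq_of_lt (n := k + 1) (by push_cast; ring) (by linarith) (by linarith)
  rw [h3]
  refine ⟨?_, div_neg_of_neg_of_pos (by linarith) (by linarith)⟩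
  push_cast
  ring

theorem diskPartner_mem_axisInterval {s : slitDisk} {k : ℕ} (hs : s.1 ∈ lowerArc (k + 2)) :
    (diskPartner V s : ℝ × ℝ) ∈ axisInterval (k + 1) := by
  have h := (mem_lowerArc_iff (shift_ne_zero (V := V) s.2) (by omega)).1 hs
  have h1 : (1 : ℝ) < (k + 2 : ℕ) := by norm_cast; omega
  have h2 := div_sub_one_mem_Ioo h.2
  rw [mem_axisInterval_iff (shift_ne_zero (V := V) (diskPartner V s).2) (by omega),
    slitDiskHomeomorph_diskPartner, eq_coords_of_subsingleton (invert _), h.1,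
    partnerAux_int h1.ne' (sin_pi_mul_eq_zero_iff.2 ⟨(k + 2 : ℕ), Int.cast_natCast _⟩) h.2]
  push_cast
  exact ⟨⟨by linarith [h2.1], by linarith [h2.2]⟩, rfl⟩

theorem continuous_diskPartner_comp {X : Type*} [TopologicalSpace X] {g : X → slitDisk} {k : ℕ}
    (hg : Continuous g) (hX : ∀ x, (g x).1 ∈ axisInterval (k + 1) ∪ lowerArc (k + 2)) :
    Continuous fun x => diskPartner V (g x) :=
  (slitDiskHomeomorph V).symm.continuous.comp (continuousOn_partner_seam.comp_continuous
    ((slitDiskHomeomorph V).continuous.comp hg) fun x => slitDiskHomeomorph_mem_seam (hX x))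

variable (V) in
/-- The restrictions of `diskPartner`. -/
noncomputable def pairing : Pairing := fun k =>
  { toFun := fun q => ⟨diskPartner V ⟨q.1, axisInterval_subset_slitDisk (by omega) q.2⟩,
      diskPartner_mem_lowerArc q.2⟩
    invFun := fun q => ⟨diskPartner V ⟨q.1, lowerArc_subset_slitDisk (by omega) q.2⟩,
      diskPartner_mem_axisInterval q.2⟩
    left_inv := fun q => Subtype.ext (congrArg Subtype.val
      (diskPartner_diskPartner V ⟨q.1, axisInterval_subset_slitDisk (by omega) q.2⟩) :)
    right_inv := fun q => Subtype.ext (congrArg Subtype.val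
      (diskPartner_diskPartner V ⟨q.1, lowerArc_subset_slitDisk (by omega) q.2⟩) :)
    continuous_toFun := Continuous.subtype_mk (continuous_subtype_val.comp
      (continuous_diskPartner_comp (Continuous.subtype_mk continuous_subtype_val _)
        fun q => Or.inl q.2)) _
    continuous_invFun := Continuous.subtype_mk (continuous_subtype_val.comp
      (continuous_diskPartner_comp (Continuous.subtype_mk continuous_subtype_val _)
        fun q => Or.inr q.2)) _ }

/-- The centre of inversion lies on the axis, so inversion commutes with the reflection. -/
theorem eq_diskPartner_of_reflect {s t : slitDisk} (hs : 0 < s.1.2)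
    (h : t.1 = (s.1.1, -s.1.2)) : t = diskPartner V s := by
  have h0 := shift_ne_zero (V := V) s.2
  have hb := (invert_shift_snd_pos_iff h0).2 hs
  refine (slitDiskHomeomorph V).injective (Subtype.ext ?_)
  change invert (shift V t.1) = invert (shift V (diskPartner V s))
  have h1 : Real.sin (Real.pi * (invert (shift V s.1)).1) ≠ 0 :=
    (slitDiskHomeomorph V s).2.2.resolve_left hb.not_gt
  rw [slitDiskHomeomorph_diskPartner, eq_coords_of_subsingleton (invert (shift V s)),
    partnerAux_of_ne h1 hb.ne', h]
  refine Prod.ext ?_ (Prod.ext ?_ (Subsingleton.elim _ _))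
  · simp only [invert_fst, sqNorm_shift, neg_sq]
    simp only [shift]
  · simp only [invert_snd_fst, sqNorm_shift, neg_sq]
    simp only [shift, mul_neg]

/-- On the unit circle the inverted height is `y/(1+x)`. Changing the sign of `x` gives `y/(1-x)`,
and the product of the two is `y²/(1-x²) = 1`, so the fold becomes `b ↦ b⁻¹`. -/
theorem eq_diskPartner_of_fold {s t : slitDisk} (hs : s.1 ∈ lowerArc 1)
    (h : t.1 = (-s.1.1, s.1.2)) : t = diskPartner V s := by
  have h0 := shift_ne_zero (V := V) s.2
  have h2 := (mem_lowerArc_iff h0 le_rfl).1 hs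
  have hc : s.1.1 ^ 2 + s.1.2 ^ 2 = 1 := by simpa using hs.1
  have hy : s.1.2 < 0 := hs.2
  have hx1 : s.1.1 + 1 ≠ 0 := by
    intro h
    have : s.1.1 = -1 := by linarith
    rw [this] at hc
    nlinarith
  have hx2 : -s.1.1 + 1 ≠ 0 := by
    intro h
    have : s.1.1 = 1 := by linarith
    rw [this] at hc
    nlinarith
  refine (slitDiskHomeomorph V).injective (Subtype.ext ?_)
  change invert (shift V t.1) = invert (shift V (diskPartner V s))
  rw [slitDiskHomeomorph_diskPartner, eq_coords_of_subsingleton (invert (shift V s)), h2.1,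
    Nat.cast_one, partnerAux_one h2.2, h]
  have h3 : (-s.1.1 + 1) ^ 2 + s.1.2 ^ 2 = 2 * (-s.1.1 + 1) := by linear_combination hc
  have h4 : (s.1.1 + 1) ^ 2 + s.1.2 ^ 2 = 2 * (s.1.1 + 1) := by linear_combination hc
  refine Prod.ext ?_ (Prod.ext ?_ (Subsingleton.elim _ _))
  · rw [invert_fst, sqNorm_shift, h3]
    simp only [shift]
    field_simp
  · simp only [invert_snd_fst, sqNorm_shift, h3, h4]
    simp only [shift]
    have := hy.ne
    field_simp
    linear_combination hc

theorem Glue.eq_diskPartner {s t : slitDisk} (h : Glue (pairing V) s t) : t = diskPartner V s := by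
  cases h with
  | reflect _ _ hq h => exact eq_diskPartner_of_reflect hq h
  | fold _ _ hq h => exact eq_diskPartner_of_fold hq h
  | pair k _ _ hq h => exact Subtype.ext h

theorem glue_of_snd_pos {s : slitDisk} (hs : 0 < s.1.2) :
    Glue (pairing V) s (diskPartner V s) := by
  have h0 := shift_ne_zero (V := V) s.2
  have hb := (invert_shift_snd_pos_iff h0).2 hs
  have h1 := (slitDiskHomeomorph V s).2.2.resolve_left hb.not_gt
  have hmem : ((s.1.1, -s.1.2) : ℝ × ℝ) ∈ slitDisk := by
    refine ⟨?_, ?_⟩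
    · have : s.1.1 ^ 2 + s.1.2 ^ 2 ≤ 1 := s.2.1
      simpa using this
    · rw [mem_iUnion₂]
      rintro ⟨n, -, -, h⟩
      linarith [show 0 ≤ -s.1.2 from h]
  exact .reflect _ _ hs (congrArg Subtype.val
    (eq_diskPartner_of_reflect (V := V) (t := ⟨_, hmem⟩) hs rfl)).symm

theorem glue_of_mem_axisInterval {s : slitDisk} {k : ℕ} (hs : s.1 ∈ axisInterval (k + 1)) :
    Glue (pairing V) s (diskPartner V s) := .pair k _ _ hs rfl

theorem glue_of_mem_lowerArc {s : slitDisk} (hs : s.1 ∈ lowerArc 1) :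
    Glue (pairing V) s (diskPartner V s) := by
  have hmem : ((-s.1.1, s.1.2) : ℝ × ℝ) ∈ slitDisk := by
    refine lowerArc_subset_slitDisk le_rfl ⟨?_, hs.2⟩
    have := hs.1
    simpa using this
  exact .fold _ _ hs (congrArg Subtype.val
    (eq_diskPartner_of_fold (V := V) (t := ⟨_, hmem⟩) hs rfl)).symm

theorem glue_diskPartner (s : slitDisk) :
    Glue (pairing V) s (diskPartner V s) ∨ Glue (pairing V) (diskPartner V s) s := by
  have h0 := shift_ne_zero (V := V) s.2
  have hw := (slitDiskHomeomorph V s).2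
  have ha1 : (1 : ℝ) ≤ (invert (shift V s.1)).1 := hw.1
  by_cases hs : Real.sin (Real.pi * (invert (shift V s.1)).1) = 0
  · have hb : (invert (shift V s.1)).2.1 < 0 := hw.2.resolve_right (not_not.2 hs)
    obtain ⟨n, hn⟩ := sin_pi_mul_eq_zero_iff.1 hs
    have hn1 : 1 ≤ n := by rw [← hn] at ha1; exact_mod_cast ha1
    lift n to ℕ using by omega
    have hn2 : (invert (shift V s.1)).1 = n := by rw [← hn]; simp
    have hmem : s.1 ∈ lowerArc n := (mem_lowerArc_iff h0 (by omega)).2 ⟨hn2, hb⟩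
    -- The wall `n = 1` is folded onto itself. The wall `k + 2` is the target of the interval `k +
    -- 1`, so there the generating relation runs backwards.
    obtain _ | _ | k := n
    · omega
    · exact Or.inl (glue_of_mem_lowerArc hmem)
    · right
      have h := glue_of_mem_axisInterval (V := V) (diskPartner_mem_axisInterval (V := V) hmem)
      rwa [diskPartner_diskPartner] at h
  · rcases lt_trichotomy s.1.2 0 with h | h | h
    · right
      have hpos : 0 < (diskPartner V s : ℝ × ℝ).2 := by
        have hb : (invert (shift V s.1)).2.1 < 0 :=
          lt_of_not_ge fun h' => h.not_ge ((invert_shift_snd_nonneg_iff h0).1 h')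
        rw [← invert_shift_snd_pos_iff (shift_ne_zero (V := V) (diskPartner V s).2),
          slitDiskHomeomorph_diskPartner, eq_coords_of_subsingleton (invert (shift V s)),
          partnerAux_of_ne hs hb.ne]
        exact neg_pos.2 hb
      have h := glue_of_snd_pos (V := V) hpos
      rwa [diskPartner_diskPartner] at h
    · left
      obtain ⟨k, hk⟩ : ∃ k : ℕ, ⌊(invert (shift V s.1)).1⌋ = (k + 1 : ℕ) := by
        have h1 : 1 ≤ ⌊(invert (shift V s.1)).1⌋ := Int.le_floor.2 (by simpa using ha1)
        exact ⟨(⌊(invert (shift V s.1)).1⌋ - 1).toNat, by omega⟩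
      have hk1 : Int.fract (invert (shift V s.1)).1 = (invert (shift V s.1)).1 - (k + 1 : ℕ) := by
        rw [Int.fract, hk, Int.cast_natCast]
      have h2 := fract_pos_of_sin_ne_zero hs
      have h3 := Int.fract_lt_one (invert (shift V s.1)).1
      rw [hk1] at h2 h3
      refine glue_of_mem_axisInterval (k := k) ((mem_axisInterval_iff h0 (by omega)).2
        ⟨⟨by linarith, by linarith⟩, (invert_shift_snd_eq_zero_iff h0).2 h⟩)
    · exact Or.inl (glue_of_snd_pos h)

/-- Each generator joins a point to its partner, and each point is joined to its partner in one
direction or the other. As `diskPartner` is an involution, the generated classes are the pairs. -/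
theorem identify_eq_iff (s t : slitDisk) :
    identify (pairing V) t = identify (pairing V) s ↔ t = s ∨ t = diskPartner V s := by
  constructor
  · intro h
    have := Quot.eqvGen_exact h
    clear h
    induction this with
    | rel _ _ h => exact Or.inr (by rw [h.eq_diskPartner, diskPartner_diskPartner])
    | refl _ => exact Or.inl rfl
    | symm _ _ _ ih =>
      rcases ih with rfl | rfl
      · exact Or.inl rfl
      · exact Or.inr (diskPartner_diskPartner V _).symm
    | trans _ _ _ _ _ ih1 ih2 =>
      rcases ih1 with rfl | rfl <;> rcases ih2 with rfl | rfl <;>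
        simp [diskPartner_diskPartner]
  · rintro (rfl | rfl)
    · rfl
    · rcases glue_diskPartner (V := V) s with h | h
      · exact (Quot.sound h).symm
      · exact Quot.sound h

theorem slitDiskHomeomorph_bottom : slitDiskHomeomorph V bottom = halfSpaceBottom V := by
  refine Subtype.ext (Prod.ext ?_ (Prod.ext ?_ (Subsingleton.elim _ _)))
  · change (invert (shift V ((0 : ℝ), (-1 : ℝ)))).1 = 1
    rw [invert_fst, sqNorm_shift]
    norm_num [shift]
  · change (invert (shift V ((0 : ℝ), (-1 : ℝ)))).2.1 = -1
    rw [invert_snd_fst, sqNorm_shift]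
    norm_num [shift]

variable (V) in
/-- The identification map in the coordinates of the slit half-plane. -/
noncomputable def halfSpaceIdentify (w : slitHalfSpace V) : Image (pairing V) :=
  identify (pairing V) ((slitDiskHomeomorph V).symm w)

theorem halfSpaceIdentify_eq_iff (w z : slitHalfSpace V) :
    halfSpaceIdentify V z = halfSpaceIdentify V w ↔ z = w ∨ z = partner w := by
  unfold halfSpaceIdentify
  rw [identify_eq_iff, diskPartner, Homeomorph.apply_symm_apply,
    (slitDiskHomeomorph V).symm.injective.eq_iff, (slitDiskHomeomorph V).symm.injective.eq_iff]

theorem isQuotientMap_halfSpaceIdentify : IsQuotientMap (halfSpaceIdentify V) :=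
  isQuotientMap_quot_mk.comp (slitDiskHomeomorph V).symm.isQuotientMap

end Gluing

/-! ### The unit square as a model of the disk. -/

section Square

theorem convex_solidDisk : Convex ℝ {q : ℝ × ℝ | q.1 ^ 2 + q.2 ^ 2 ≤ 1} := by
  have h1 : ConvexOn ℝ univ fun x : ℝ => x ^ 2 := even_two.convexOn_pow
  have h2 : ConvexOn ℝ univ fun q : ℝ × ℝ => q.1 ^ 2 + q.2 ^ 2 :=
    (h1.comp_linearMap (LinearMap.fst ℝ ℝ ℝ)).add (h1.comp_linearMap (LinearMap.snd ℝ ℝ ℝ))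
  simpa using h2.convex_le 1

/-- The square is homeomorphic to the disk, with boundary points going to boundary points. -/
theorem exists_homeomorph_solidDisk_unitSquare : ∃ e : (ℝ × ℝ) ≃ₜ (ℝ × ℝ),
    e '' {q : ℝ × ℝ | q.1 ^ 2 + q.2 ^ 2 ≤ 1} = unitSquare ∧ e (-1, 0) ∈ frontier unitSquare := by
  have hclosed : IsClosed {q : ℝ × ℝ | q.1 ^ 2 + q.2 ^ 2 ≤ 1} :=
    isClosed_le (by fun_prop) continuous_const
  have hint : (interior {q : ℝ × ℝ | q.1 ^ 2 + q.2 ^ 2 ≤ 1}).Nonempty :=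
    ⟨0, interior_maximal (s := {q : ℝ × ℝ | q.1 ^ 2 + q.2 ^ 2 ≤ 1})
      (t := {q : ℝ × ℝ | q.1 ^ 2 + q.2 ^ 2 < 1}) (fun q (hq : q.1 ^ 2 + q.2 ^ 2 < 1) => hq.le)
      (isOpen_lt (by fun_prop) continuous_const) (by simp)⟩
  have hbdd : Bornology.IsBounded {q : ℝ × ℝ | q.1 ^ 2 + q.2 ^ 2 ≤ 1} := by
    refine (Metric.isBounded_Icc ((-1, -1) : ℝ × ℝ) (1, 1)).subset fun q hq => ?_
    have hq' : q.1 ^ 2 + q.2 ^ 2 ≤ 1 := hq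
    exact ⟨⟨by nlinarith, by nlinarith⟩, ⟨by nlinarith, by nlinarith⟩⟩
  have hsq : unitSquare = Icc ((0, 0) : ℝ × ℝ) (1, 1) := Icc_prod_Icc _ _ _ _
  have hsqc : IsClosed unitSquare := isClosed_Icc.prod isClosed_Icc
  -- Bounded convex sets with nonempty interior correspond under a homeomorphism of the plane that
  -- also matches their closures and frontiers.
  obtain ⟨e, -, h2, h3⟩ := exists_homeomorph_image_eq convex_solidDisk hint
    (NormedSpace.isVonNBounded_of_isBounded ℝ hbdd) (t := unitSquare)
    ((convex_Icc 0 1).prod (convex_Icc 0 1))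
    ⟨(1 / 2, 1 / 2), by
      rw [unitSquare, interior_prod_eq, interior_Icc]
      norm_num⟩
    (NormedSpace.isVonNBounded_of_isBounded ℝ (hsq ▸ Metric.isBounded_Icc _ _))
  rw [hclosed.closure_eq, hsqc.closure_eq] at h2
  refine ⟨e, h2, h3 ▸ mem_image_of_mem e ?_⟩
  rw [hclosed.frontier_eq]
  refine ⟨by simp, fun h => ?_⟩
  -- The points `(-1 - t, 0)` with `t > 0` lie outside the disk and tend to `(-1,0)`, which is
  -- therefore not interior.
  have hc : Tendsto (fun t : ℝ => ((-1 - t, 0) : ℝ × ℝ)) (𝓝[>] 0) (𝓝 (-1, 0)) := by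
    have : Continuous fun t : ℝ => ((-1 - t, 0) : ℝ × ℝ) := by fun_prop
    have := this.tendsto 0
    simp only [sub_zero] at this
    exact this.mono_left nhdsWithin_le_nhds
  obtain ⟨t, ht, ht0⟩ := ((hc.eventually_mem (mem_interior_iff_mem_nhds.1 h)).and
    self_mem_nhdsWithin).exists
  have ht' : (-1 - t) ^ 2 + 0 ^ 2 ≤ 1 := ht
  have ht0' : 0 < t := ht0
  nlinarith

/-- A point of the plane as a point of `ℝ × ℝ × V`, for a trivial space `V`. -/
def planeHomeomorph (V : Type*) [NormedAddCommGroup V] [Subsingleton V] :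
    (ℝ × ℝ) ≃ₜ (ℝ × ℝ × V) where
  toFun q := (q.1, q.2, 0)
  invFun u := (u.1, u.2.1)
  left_inv _ := rfl
  right_inv _ := Prod.ext rfl (Prod.ext rfl (Subsingleton.elim _ _))
  continuous_toFun := by fun_prop
  continuous_invFun := by fun_prop

theorem exists_homeomorph_puncturedSquare (V : Type*) [NormedAddCommGroup V] [NormedSpace ℝ V]
    [Subsingleton V] : ∃ p : unitSquare, (p : ℝ × ℝ) ∈ frontier unitSquare ∧
      Nonempty ({q : unitSquare // q ≠ p} ≃ₜ slitHalfSpace V) := by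
  obtain ⟨e, h1, h2⟩ := exists_homeomorph_solidDisk_unitSquare
  have hiff : ∀ q, q ∈ unitSquare ↔ planeHomeomorph V (e.symm q) ∈ solidBall V := by
    intro q
    rw [← h1, e.image_eq_preimage_symm]
    simp [solidBall, planeHomeomorph, sqNorm]
  let E : unitSquare ≃ₜ solidBall V := (e.symm.trans (planeHomeomorph V)).subtype hiff
  refine ⟨E.symm (pole V), ?_, ⟨((E.subtype fun q => ?_).trans
    (puncturedBallHomeomorph V)).trans (halfSpaceHomeomorph V)⟩⟩
  · have h3 : (E.symm (pole V) : ℝ × ℝ) = e (-1, 0) := rfl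
    rwa [h3]
  · rw [ne_eq, ne_eq, E.eq_symm_apply]

end Square

/-! ### Balls of every dimension at least two. -/

section Ball

/-- The first two coordinates and the others. -/
noncomputable def splitHomeomorph (m : ℕ) :
    EuclideanSpace ℝ (Fin (m + 2)) ≃ₜ ℝ × ℝ × EuclideanSpace ℝ (Fin m) where
  toFun x := (x 0, x 1, WithLp.toLp 2 fun i => x i.succ.succ)
  invFun u := WithLp.toLp 2 (Fin.cons u.1 (Fin.cons u.2.1 u.2.2) : Fin (m + 2) → ℝ)
  left_inv x := by
    ext i
    refine Fin.cases rfl (fun i => Fin.cases rfl (fun i => rfl) i) i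
  right_inv u := rfl
  continuous_toFun := by fun_prop
  continuous_invFun := by
    refine (PiLp.continuous_toLp 2 _).comp (continuous_pi fun i => ?_)
    refine Fin.cases (by simpa using continuous_fst) (fun i => ?_) i
    refine Fin.cases (by simpa using continuous_snd.fst) (fun i => ?_) i
    simp only [Fin.cons_succ]
    fun_prop

theorem sqNorm_splitHomeomorph {m : ℕ} (x : EuclideanSpace ℝ (Fin (m + 2))) :
    sqNorm (splitHomeomorph m x) = ‖x‖ ^ 2 := by
  simp only [sqNorm, splitHomeomorph, Homeomorph.homeomorph_mk_coe, 
    EuclideanSpace.norm_sq_eq, Fin.sum_univ_succ, Real.norm_eq_abs, sq_abs]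
  rw [add_assoc]
  rfl

theorem exists_isTwoToOne_ball (m : ℕ) : ∃ (Y : Type) (_ : MetricSpace Y)
    (f : Metric.closedBall (0 : EuclideanSpace ℝ (Fin (m + 2))) 1 → Y),
      Function.Surjective f ∧ IsTwoToOne f ∧ ∃! x, ¬ ContinuousAt f x := by
  classical
  let V := EuclideanSpace ℝ (Fin m)
  -- No planar gluing data is prescribed here, so the quotient is taken by the involution itself.
  let f : slitHalfSpace V → Quot (fun w z : slitHalfSpace V => z = partner w) := Quot.mk _
  have hfib : ∀ w z, f z = f w ↔ z = w ∨ z = partner w := by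
    intro w z
    constructor
    · intro h
      have := Quot.eqvGen_exact h
      clear h
      induction this with
      | rel _ _ h => exact Or.inr (by rw [h, partner_partner])
      | refl _ => exact Or.inl rfl
      | symm _ _ _ ih =>
        rcases ih with rfl | rfl
        · exact Or.inl rfl
        · exact Or.inr (partner_partner _).symm
      | trans _ _ _ _ _ ih1 ih2 =>
        rcases ih1 with rfl | rfl <;> rcases ih2 with rfl | rfl <;> simp [partner_partner]
    · rintro (rfl | rfl)
      · rfl
      · exact (Quot.sound (r := fun w z : slitHalfSpace V => z = partner w) rfl).symm
  have hf : IsQuotientMap f := isQuotientMap_quot_mk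
  obtain ⟨_, -, _, -⟩ := metrizableSpace_and_locallyCompactSpace_of_isQuotientMap hfib hf
  have hiff : ∀ x : EuclideanSpace ℝ (Fin (m + 2)),
      x ∈ Metric.closedBall 0 1 ↔ splitHomeomorph m x ∈ solidBall V := by
    intro x
    change _ ↔ sqNorm (splitHomeomorph m x) ≤ 1
    rw [sqNorm_splitHomeomorph, mem_closedBall_zero_iff, sq_le_one_iff₀ (norm_nonneg x)]
  let E : Metric.closedBall (0 : EuclideanSpace ℝ (Fin (m + 2))) 1 ≃ₜ solidBall V :=
    (splitHomeomorph m).subtype hiff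
  let p := E.symm (pole V)
  let h : {q // q ≠ p} ≃ₜ slitHalfSpace V := ((E.subtype fun q => by
    rw [ne_eq, ne_eq, E.eq_symm_apply]).trans (puncturedBallHomeomorph V)).trans
      (halfSpaceHomeomorph V)
  let F : Metric.closedBall (0 : EuclideanSpace ℝ (Fin (m + 2))) 1 → _ := fun q =>
    if hq : q = p then f (halfSpaceBottom V) else f (h ⟨q, hq⟩)
  have hFp : F p = f (halfSpaceBottom V) := dif_pos rfl
  have hF : ∀ q (hq : q ≠ p), F q = f (h ⟨q, hq⟩) := fun q hq => dif_neg hq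
  refine ⟨_, metrizableSpaceMetric _, F, surjective_of_extension h.toEquiv hf.surjective hF,
    isTwoToOne_of_extension h.toEquiv hFp hF (preimage_image_bottom hfib)
      fun s hs => ncard_preimage_image hfib hs, p, ?_, ?_⟩
  · exact not_continuousAt_of_extension hfib h hf.continuous hF
  · intro q hq
    by_contra hqp
    exact hq (continuousAt_of_extension h hf.continuous hF hqp)

end Ball

end Kuperberg

/-! ### Assembly of the planar example, its compact versions and the balls. -/

namespace Kuperberg

theorem IsTwoToOne.comp_left {X Y Z : Type*} {f : X → Y} {j : Y → Z} (hf : IsTwoToOne f)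
    (hj : Function.Injective j) : IsTwoToOne (j ∘ f) := by
  rintro _ ⟨x, rfl⟩
  have h : j ∘ f ⁻¹' {(j ∘ f) x} = f ⁻¹' {f x} := by
    ext z
    exact hj.eq_iff
  rw [h]
  exact hf _ ⟨x, rfl⟩

end Kuperberg

open Kuperberg in
theorem mainTheorem1 :
    -- the example on the unit square
    (∃ p : Kuperberg.unitSquare, (p : ℝ × ℝ) ∈ frontier Kuperberg.unitSquare ∧
      ∃ (h : {q : Kuperberg.unitSquare // q ≠ p} ≃ₜ Kuperberg.slitDisk) (φ : Kuperberg.Pairing),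
        -- the identification map on the slit disk
        Continuous (Kuperberg.identify φ) ∧
        (∀ s : Kuperberg.slitDisk, s ≠ Kuperberg.bottom →
          (Kuperberg.identify φ ⁻¹' {Kuperberg.identify φ s}).ncard = 2) ∧
        Kuperberg.identify φ ⁻¹' {Kuperberg.identify φ Kuperberg.bottom} = {Kuperberg.bottom} ∧
        -- its image
        TopologicalSpace.MetrizableSpace (Kuperberg.Image φ) ∧
        LocallyCompactSpace (Kuperberg.Image φ) ∧
        ConnectedSpace (Kuperberg.Image φ) ∧
        NoncompactSpace (Kuperberg.Image φ) ∧
        -- the 2-to-1 function on the square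
        Function.Surjective (Kuperberg.kuperbergFun p h φ) ∧
        Kuperberg.IsTwoToOne (Kuperberg.kuperbergFun p h φ) ∧
        (∀ q, ¬ ContinuousAt (Kuperberg.kuperbergFun p h φ) q ↔ q = p) ∧
        -- making the image a continuum
        (∀ c : Kuperberg.Image φ,
          TopologicalSpace.MetrizableSpace
            (Kuperberg.PinchedCompactification (Kuperberg.Image φ) c) ∧
          CompactSpace (Kuperberg.PinchedCompactification (Kuperberg.Image φ) c) ∧
          ConnectedSpace (Kuperberg.PinchedCompactification (Kuperberg.Image φ) c) ∧
          Continuous (Kuperberg.toPinched c) ∧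
          Function.Bijective (Kuperberg.toPinched c) ∧
          Function.Surjective (Kuperberg.toPinched c ∘ Kuperberg.kuperbergFun p h φ) ∧
          Kuperberg.IsTwoToOne (Kuperberg.toPinched c ∘ Kuperberg.kuperbergFun p h φ) ∧
          (∀ q, ¬ ContinuousAt (Kuperberg.toPinched c ∘ Kuperberg.kuperbergFun p h φ) q ↔
            q = p))) ∧
    -- the disk and the higher-dimensional balls
    (∀ n : ℕ, 2 ≤ n → ∃ (Y : Type) (_ : MetricSpace Y)
      (f : Metric.closedBall (0 : EuclideanSpace ℝ (Fin n)) 1 → Y),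
        Function.Surjective f ∧ Kuperberg.IsTwoToOne f ∧ ∃! x, ¬ ContinuousAt f x) := by
  refine ⟨?_, fun n hn => ?_⟩
  -- A zero-dimensional `V` makes the plane an instance of the general model.
  · let V := EuclideanSpace ℝ (Fin 0)
    obtain ⟨p, hp, ⟨h⟩⟩ := exists_homeomorph_puncturedSquare V
    have hfib := halfSpaceIdentify_eq_iff (V := V)
    have hq := isQuotientMap_halfSpaceIdentify (V := V)
    obtain ⟨_, _, hm, hl⟩ := metrizableSpace_and_locallyCompactSpace_of_isQuotientMap hfib hq
    have := connectedSpace_slitHalfSpace V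
    have hconn : ConnectedSpace (Image (pairing V)) := hq.surjective.connectedSpace hq.continuous
    have hnon := noncompactSpace_of_isQuotientMap hfib hq
    have : CompactSpace unitSquare :=
      isCompact_iff_compactSpace.1 (isCompact_Icc.prod isCompact_Icc)
    have hid : ∀ s, identify (pairing V) s = halfSpaceIdentify V (slitDiskHomeomorph V s) := by
      intro s
      simp [halfSpaceIdentify]
    have hpre : ∀ y, identify (pairing V) ⁻¹' {y} =
        (slitDiskHomeomorph V).symm '' (halfSpaceIdentify V ⁻¹' {y}) := by
      intro y
      rw [Homeomorph.image_symm]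
      ext s
      simp [hid]
    have hbot : identify (pairing V) ⁻¹' {identify (pairing V) bottom} = {bottom} := by
      rw [hpre, hid, slitDiskHomeomorph_bottom, preimage_image_bottom hfib, image_singleton,
        ← slitDiskHomeomorph_bottom, Homeomorph.symm_apply_apply]
    have htwo : ∀ s, s ≠ bottom →
        (identify (pairing V) ⁻¹' {identify (pairing V) s}).ncard = 2 := by
      intro s hs
      rw [hpre, hid, ncard_image_of_injective _ (slitDiskHomeomorph V).symm.injective]
      refine ncard_preimage_image hfib fun h => hs ?_
      rw [← slitDiskHomeomorph_bottom] at h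
      exact (slitDiskHomeomorph V).injective h
    let k := h.trans (slitDiskHomeomorph V).symm
    let F := kuperbergFun p k (pairing V)
    have hFp : F p = identify (pairing V) bottom := dif_pos rfl
    have hF : ∀ q (hq : q ≠ p), F q = identify (pairing V) (k ⟨q, hq⟩) := fun q hq => dif_neg hq
    -- As `k` ends with the inverse of `slitDiskHomeomorph`, this is the same equation read in
    -- half-plane coordinates.
    have hF' : ∀ q (hq : q ≠ p), F q = halfSpaceIdentify V (h ⟨q, hq⟩) := hF
    have hc : Continuous (identify (pairing V)) := continuous_quot_mk
    have hsurj : Function.Surjective F := surjective_of_extension k.toEquiv Quot.mk_surjective hF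
    have htto : IsTwoToOne F := isTwoToOne_of_extension k.toEquiv hFp hF hbot htwo
    have hcont : ∀ q, q ≠ p → ContinuousAt F q := fun q hq => continuousAt_of_extension k hc hF hq
    refine ⟨p, hp, k, pairing V, hc, htwo, hbot, hm, hl, hconn, hnon, hsurj, htto, fun q => ?_,
      fun c => ?_⟩
    · refine ⟨fun hd => by_contra fun hqp => hd (hcont q hqp), ?_⟩
      rintro rfl
      exact not_continuousAt_of_extension hfib h hq.continuous hF'
    · have hm' := metrizableSpace_pinched c
      have hj := continuous_toPinched c
      have hb := toPinched_bijective c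
      refine ⟨hm', inferInstance, hb.2.connectedSpace hj, hj, hb, hb.2.comp hsurj,
        htto.comp_left hb.1, fun q => ?_⟩
      refine ⟨fun hd => by_contra fun hqp => hd (hj.continuousAt.comp (hcont q hqp)), ?_⟩
      rintro rfl
      -- The bijection `toPinched c` preserves fibres, and the discontinuity argument needs only a
      -- continuous map with these fibres into a Hausdorff space, not a quotient map.
      refine not_continuousAt_of_extension (f := toPinched c ∘ halfSpaceIdentify V)
        (fun w z => ?_) h (hj.comp hq.continuous) fun q hq => congrArg (toPinched c) (hF' q hq)
      rw [← hfib]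
      exact hb.1.eq_iff
  · obtain ⟨m, rfl⟩ := Nat.exists_eq_add_of_le' hn
    exact exists_isTwoToOne_ball m
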